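/- Let $n\ge 0$, let $X$ be a random vector in $\mathbb{R}^n$, and let $Y=X+Z$ where $Z\sim\mathcal N(0,I)$ is a standard Gaussian vector in $\mathbb{R}^n$ independent of $X$. For real $p,k\ge 1$ put $\|x\|_k=\big(\sum_{i=1}^n|x_i|^k\big)^{1/k}$ and $\ell_{p,k}(x)=\|x\|_k^p$. A measurable map $f:\mathbb{R}^n\to\mathbb{R}^n$ is called an optimal Bayesian estimator of $X$ from $Y$ if $\mathbb{E}[\ell_{p,k}(X-f(Y))]\le\mathbb{E}[\ell_{p,k}(X-g(Y))]$ for every measurable $g:\mathbb{R}^n\to\mathbb{R}^n$ (expectations in $[0,\infty]$). Assume $1\le p=k\le 2$ and let $A\in\mathbb{R}^{n\times n}$ be symmetric and positive definite. 1. Suppose $A\prec I$, i.e. $I-A$ is positive definite. Then $y\mapsto Ay$ is an optimal Bayesian estimator of $X$ from $Y$ if and only if $X\sim\mathcal N\big(0,(I-A)^{-1}A\big)$. In that case the optimal Bayesian estimator is unique almost surely: every optimal Bayesian estimator $f$ satisfies $f(Y)=AY$ almost surely. 2. If $A$ has an eigenvalue greater than or equal to $1$, then $y\mapsto Ay$ is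 not an optimal Bayesian estimator of $X$ from $Y$, whatever the distribution of $X$; that is, no probability distribution (proper prior) on $\mathbb{R}^n$ induces the linear estimator $Ay$. -/

import Mathlib

open MeasureTheory ProbabilityTheory
open scoped ENNReal Matrix

/-- The `k`-norm `‖x‖_k = (∑ i, |x i| ^ k) ^ (1 / k)` on `ℝⁿ`. -/
noncomputable def kNorm {n : ℕ} (k : ℝ) (x : EuclideanSpace ℝ (Fin n)) : ℝ :=
  (∑ i, |x i| ^ k) ^ (1 / k)

/-- The loss function `ℓ_{p,k}(x) = ‖x‖_k ^ p`. -/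
noncomputable def lossFn {n : ℕ} (p k : ℝ) (x : EuclideanSpace ℝ (Fin n)) : ℝ :=
  kNorm k x ^ p

/-- The Bayes risk `E[ℓ_{p,k}(X - f(Y))]`, with values in `[0, ∞]`. -/
noncomputable def bayesRisk {n : ℕ} {Ω : Type*} [MeasurableSpace Ω] (P : Measure Ω)
    (X Y : Ω → EuclideanSpace ℝ (Fin n)) (p k : ℝ)
    (f : EuclideanSpace ℝ (Fin n) → EuclideanSpace ℝ (Fin n)) : ℝ≥0∞ :=
  ∫⁻ ω, ENNReal.ofReal (lossFn p k (X ω - f (Y ω))) ∂P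

/-- `f` is an optimal Bayesian estimator of `X` from `Y`: it is measurable and attains the infimum
of the Bayes risk over all measurable estimators. -/
def IsOptimalEstimator {n : ℕ} {Ω : Type*} [MeasurableSpace Ω] (P : Measure Ω)
    (X Y : Ω → EuclideanSpace ℝ (Fin n)) (p k : ℝ)
    (f : EuclideanSpace ℝ (Fin n) → EuclideanSpace ℝ (Fin n)) : Prop :=
  Measurable f ∧ ∀ g : EuclideanSpace ℝ (Fin n) → EuclideanSpace ℝ (Fin n), Measurable g →
    bayesRisk P X Y p k f ≤ bayesRisk P X Y p k g

/-- The linear estimator `y ↦ A y`. -/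
noncomputable def linearEstimator {n : ℕ} (A : Matrix (Fin n) (Fin n) ℝ)
    (y : EuclideanSpace ℝ (Fin n)) : EuclideanSpace ℝ (Fin n) :=
  WithLp.toLp 2 (A *ᵥ y.ofLp)

/-! For `p = k` the loss is a sum over coordinates, and integrating out `X` at a fixed observation
`y` gives the risk as an integral over `y` of independent scalar problems: minimise `E[exp(-‖X -
y‖²/2) |X_i - c|^p]` over `c`. A continuous optimal estimator solves each of them at every `y`
(`gaussDeviation_le_of_isOptimalEstimator`).

Moving `y` by `s e_i` tilts the weight by `exp(s X_i)` and moves `(A y)_i` affinely with slope `A i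
i > 0`. After rescaling, linear optimality says that `s` minimises `∫ |t - s|^p exp(s t) dν(t)` for
every `s`. The first-order condition is that `exp(t²/2) ν(dt)` convolves to zero with the kernel `r
|r|^(p-2) exp(-r²/2)`. For `p = 2` this kernel is the derivative of a Gaussian. For `p < 2` the
Gamma integral for `|r|^(p-2)` makes it the derivative of a mixture `Q` of centred Gaussians of
variance at most `1`. The Fourier transform of `Q` is that of the standard Gaussian times a moment
generating function, and the reciprocal of the latter is the transform of an integrable function.
Hence `Q` may be replaced by the standard Gaussian, which forces `∫ exp(s t) dν` to be proportional
to `exp(s²/2)` (`integral_exp_of_minimizer_id`).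

Applied coordinate by coordinate, this shows that the density of `Y` is proportional to `exp(yᵀ(A -
1)y/2)` (`gaussAverage_eq_of_minimizer`). An eigenvalue at least `1` makes this impossible, since
the density must vanish at infinity. If `A ≺ 1`, the law of `Y` is determined, and so is that of
`X`, the Gaussian characteristic function having no zeros.

Conversely, for the Gaussian prior the error `W = X - A Y` is symmetric and independent of `Y`.
Averaging over the sign of `W`, the inequality `2 max(|w|, |d|)^p ≤ |w + d|^p + |-w + d|^p` bounds
every risk below by that of `A Y`. Equality needs `|A Y - f(Y)| ≤ |W|` coordinatewise, which
independence turns into `f(Y) = A Y` (`lintegral_max_le_bayesRisk`). -/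

/-! ### Integrability and duality for the Fourier transform -/

open scoped FourierTransform in
/-- The Fourier transform of a function with two integrable derivatives is integrable. -/
theorem integrable_fourier_of_hasDerivAt_two {f f1 f2 : ℝ → ℂ}
    (h1 : ∀ x, HasDerivAt f (f1 x) x) (h2 : ∀ x, HasDerivAt f1 (f2 x) x)
    (hf : Integrable f) (hf1 : Integrable f1) (hf2 : Integrable f2) :
    Integrable (𝓕 f) := by
  have d1 : deriv f = f1 := funext fun x => (h1 x).deriv
  have d2 : deriv f1 = f2 := funext fun x => (h2 x).deriv
  have e1 := Real.fourier_deriv hf (fun x => (h1 x).differentiableAt) (d1 ▸ hf1)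
  have e2 := Real.fourier_deriv hf1 (fun x => (h2 x).differentiableAt) (d2 ▸ hf2)
  rw [d1] at e1
  rw [d2] at e2
  have hc : Continuous (𝓕 f) := VectorFourier.fourierIntegral_continuous Real.continuous_fourierChar
    (L := innerₗ ℝ) continuous_inner hf
  have b0 : ∀ x, ‖𝓕 f x‖ ≤ ∫ v, ‖f v‖ := fun x =>
    VectorFourier.norm_fourierIntegral_le_integral_norm _ _ _ f x
  have b2 : ∀ x, ‖𝓕 f2 x‖ ≤ ∫ v, ‖f2 v‖ := fun x =>
    VectorFourier.norm_fourierIntegral_le_integral_norm _ _ _ f2 x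
  -- Both `𝓕 f` and `x² 𝓕 f` are bounded, the second through `𝓕 f2`, so `𝓕 f` decays like `1 / (1 +
  -- x²)`.
  refine (integrable_inv_one_add_sq.const_mul ((∫ v, ‖f v‖) + ∫ v, ‖f2 v‖)).mono'
    hc.aestronglyMeasurable (Filter.Eventually.of_forall fun x => ?_)
  have e : ‖𝓕 f2 x‖ = (2 * Real.pi) ^ 2 * x ^ 2 * ‖𝓕 f x‖ := by
    rw [e2, e1]
    simp only [smul_eq_mul, norm_mul, Complex.norm_I, Complex.norm_real, Complex.norm_ofNat,
      Real.norm_eq_abs, abs_of_pos Real.pi_pos, ← sq_abs x]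
    ring
  have hpi : 1 ≤ (2 * Real.pi) ^ 2 := by nlinarith [Real.pi_gt_three]
  have h3 : x ^ 2 * ‖𝓕 f x‖ ≤ ∫ v, ‖f2 v‖ := by
    refine le_trans ?_ (b2 x)
    rw [e, mul_assoc]
    exact le_mul_of_one_le_left (by positivity) hpi
  rw [← div_eq_mul_inv, le_div_iff₀ (by positivity)]
  nlinarith [b0 x]

open scoped FourierTransform in
theorem integral_fourier_mul_eq {f g : ℝ → ℂ} (hf : Integrable f) (hg : Integrable g) :
    ∫ x, 𝓕 f x * g x = ∫ x, f x * 𝓕 g x := by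
  simpa using! (VectorFourier.integral_fourierIntegral_smul_eq_flip (L := innerₗ ℝ)
      Real.continuous_fourierChar continuous_inner hf hg)

/-! ### Reciprocals of moment generating functions -/

section Mixture

variable {Θ : Type*} [MeasurableSpace Θ]

theorem integrable_pow_mul_exp_of_bounded (Λ : Measure Θ) [IsFiniteMeasure Λ] {k : Θ → ℝ}
    (hk : Measurable k) (h0 : ∀ θ, 0 ≤ k θ) (h1 : ∀ θ, k θ ≤ 1) (m : ℕ) (z : ℝ) :
    Integrable (fun θ => k θ ^ m * Real.exp (z * k θ)) Λ := by
  refine Integrable.of_bound (C := Real.exp |z|) (by fun_prop) (Filter.Eventually.of_forall fun θ => ?_)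
  rw [Real.norm_eq_abs, abs_of_nonneg (mul_nonneg (pow_nonneg (h0 θ) m) (Real.exp_pos _).le)]
  have : z * k θ ≤ |z| := by
    calc z * k θ ≤ |z| * k θ := mul_le_mul_of_nonneg_right (le_abs_self z) (h0 θ)
      _ ≤ |z| * 1 := mul_le_mul_of_nonneg_left (h1 θ) (abs_nonneg z)
      _ = |z| := mul_one _
  calc k θ ^ m * Real.exp (z * k θ) ≤ 1 * Real.exp |z| :=
        mul_le_mul (pow_le_one₀ (h0 θ) (h1 θ)) (Real.exp_le_exp.2 this) (Real.exp_pos _).le zero_le_one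
    _ = _ := one_mul _

theorem integrable_pow_mul_exp_neg_mul_sq {b : ℝ} (hb : 0 < b) (m : ℕ) :
    Integrable fun x : ℝ => x ^ m * Real.exp (-b * x ^ 2) := by
  have hm : (-1 : ℝ) < m := by linarith [Nat.cast_nonneg (α := ℝ) m]
  simpa only [Real.rpow_natCast] using integrable_rpow_mul_exp_neg_mul_sq hb hm

open scoped FourierTransform in
/-- The reciprocal of a moment generating function of a variable in `[0, 1]`, evaluated
at `c x²`, has an integrable Fourier transform. -/
theorem integrable_fourier_inv_mgf_sq (Λ : Measure Θ) [IsFiniteMeasure Λ] {k : Θ → ℝ}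
    (hk : Measurable k) (h0 : ∀ θ, 0 ≤ k θ) (h1 : ∀ θ, k θ ≤ 1)
    (hΛ : Λ {θ | 1 / 2 ≤ k θ} ≠ 0) {c : ℝ} (hc : 0 < c) :
    Integrable (fun x : ℝ => ((mgf k Λ (c * x ^ 2) : ℝ) : ℂ)⁻¹) ∧
    Integrable (𝓕 fun x : ℝ => ((mgf k Λ (c * x ^ 2) : ℝ) : ℂ)⁻¹) := by
  have hint := integrable_pow_mul_exp_of_bounded Λ hk h0 h1
  have hset : integrableExpSet k Λ = Set.univ := by
    ext z
    simpa [integrableExpSet] using hint 0 z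
  set M : ℕ → ℝ → ℝ := fun m z => ∫ θ, k θ ^ m * Real.exp (z * k θ) ∂Λ with hM
  have hMd : ∀ m z, HasDerivAt (M m) (M (m + 1) z) z := fun m z =>
    hasDerivAt_integral_pow_mul_exp_real (by simp [hset]) m
  have hW : ∀ z, mgf k Λ z = M 0 z := fun z => by simp [mgf, hM]
  have hM0 : ∀ m z, 0 ≤ M m z := fun m z => integral_nonneg fun θ =>
    mul_nonneg (pow_nonneg (h0 θ) m) (Real.exp_pos _).le
  -- As `0 ≤ k ≤ 1`, the weighted moments decrease in `m`. All ratios `M m / M 0` therefore lie in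
  -- `[0, 1]`, which controls the derivatives of `1 / M 0`.
  have hMs : ∀ m z, M (m + 1) z ≤ M m z := fun m z => by
    refine integral_mono (hint _ _) (hint _ _) fun θ => ?_
    exact mul_le_mul_of_nonneg_right (pow_le_pow_of_le_one (h0 θ) (h1 θ) (Nat.le_succ m))
      (Real.exp_pos _).le
  -- The mass `δ` of `{k ≥ 1/2}` forces exponential growth of `M 0`, hence Gaussian decay of its
  -- reciprocal at `c x²`.
  set δ : ℝ := Λ.real {θ | 1 / 2 ≤ k θ} with hδ
  have hδ0 : 0 < δ := ENNReal.toReal_pos hΛ (measure_ne_top _ _)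
  have hlow : ∀ z, 0 ≤ z → δ * Real.exp (z / 2) ≤ M 0 z := fun z hz => by
    have hms : MeasurableSet {θ | 1 / 2 ≤ k θ} := measurableSet_le measurable_const hk
    calc δ * Real.exp (z / 2) = ∫ θ in {θ | 1 / 2 ≤ k θ}, Real.exp (z / 2) ∂Λ := by
          simp [hδ]
      _ ≤ ∫ θ in {θ | 1 / 2 ≤ k θ}, k θ ^ 0 * Real.exp (z * k θ) ∂Λ := by
          refine setIntegral_mono_on (integrable_const _) (hint 0 z).integrableOn hms fun θ hθ => ?_
          simp only [pow_zero, one_mul, Set.mem_ofPred_eq] at hθ ⊢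
          exact Real.exp_le_exp.2 (by nlinarith)
      _ ≤ M 0 z := setIntegral_le_integral (hint 0 z) (Filter.Eventually.of_forall fun θ => by
          simp [(Real.exp_pos _).le])
  clear_value M
  have hpos : ∀ x : ℝ, 0 < M 0 (c * x ^ 2) := fun x =>
    lt_of_lt_of_le (by positivity) (hlow _ (by positivity))
  set j : ℝ → ℝ := fun x => (M 0 (c * x ^ 2))⁻¹ with hj
  set j1 : ℝ → ℝ := fun x => -(M 1 (c * x ^ 2) * (2 * c * x)) / M 0 (c * x ^ 2) ^ 2 with hj1
  set N2 : ℝ → ℝ := fun x =>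
    M 2 (c * x ^ 2) * (2 * c * x) * (2 * c * x) + M 1 (c * x ^ 2) * (2 * c) with hN2
  set j2 : ℝ → ℝ := fun x => (-(N2 x) * M 0 (c * x ^ 2) ^ 2 -
    -(M 1 (c * x ^ 2) * (2 * c * x)) * (2 * M 0 (c * x ^ 2) * (M 1 (c * x ^ 2) * (2 * c * x))))
      / (M 0 (c * x ^ 2) ^ 2) ^ 2 with hj2
  have hq : ∀ x : ℝ, HasDerivAt (fun x : ℝ => c * x ^ 2) (2 * c * x) x := fun x => by
    have := (hasDerivAt_pow 2 x).const_mul c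
    refine this.congr_deriv ?_
    simp only [Nat.cast_ofNat, Nat.add_one_sub_one, pow_one]
    ring
  have hl : ∀ x : ℝ, HasDerivAt (fun x : ℝ => 2 * c * x) (2 * c) x := fun x => by
    simpa using (hasDerivAt_id x).const_mul (2 * c)
  have hD : ∀ m (x : ℝ), HasDerivAt (fun x : ℝ => M m (c * x ^ 2))
      (M (m + 1) (c * x ^ 2) * (2 * c * x)) x := fun m x => (hMd m _).comp x (hq x)
  have hjd : ∀ x, HasDerivAt j (j1 x) x := fun x => (hD 0 x).inv (hpos x).ne'
  have hjd1 : ∀ x, HasDerivAt j1 (j2 x) x := fun x => by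
    have e1 : HasDerivAt (fun x => -(M 1 (c * x ^ 2) * (2 * c * x))) (-(N2 x)) x :=
      ((hD 1 x).mul (hl x)).neg
    have e2 : HasDerivAt (fun x => M 0 (c * x ^ 2) ^ 2)
        (2 * M 0 (c * x ^ 2) * (M 1 (c * x ^ 2) * (2 * c * x))) x := by
      have := (hD 0 x).fun_pow 2
      simp only [Nat.cast_ofNat, Nat.add_one_sub_one, pow_one, zero_add] at this
      exact this
    exact e1.div e2 (pow_pos (hpos x) 2).ne'
  have hjb : ∀ x, j x ≤ δ⁻¹ * Real.exp (-(c / 2) * x ^ 2) := fun x => by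
    have := hlow (c * x ^ 2) (by positivity)
    rw [hj]
    calc (M 0 (c * x ^ 2))⁻¹ ≤ (δ * Real.exp (c * x ^ 2 / 2))⁻¹ :=
          inv_anti₀ (by positivity) this
      _ = _ := by rw [mul_inv, ← Real.exp_neg]; ring_nf
  have hj0 : ∀ x, 0 < j x := fun x => inv_pos.2 (hpos x)
  have hj1b : ∀ x, |j1 x| ≤ 2 * c * |x| * j x := fun x => by
    have hp := hpos x
    have a := hMs 0 (c * x ^ 2)
    have b := hM0 1 (c * x ^ 2)
    simp only [hj1, hj, abs_div, abs_neg, abs_mul, abs_of_nonneg b, abs_pow, abs_of_pos hp,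
      abs_of_pos hc, abs_two]
    rw [div_le_iff₀ (by positivity)]
    have : 2 * c * |x| * (M 0 (c * x ^ 2))⁻¹ * M 0 (c * x ^ 2) ^ 2
        = M 0 (c * x ^ 2) * (2 * c * |x|) := by field_simp
    rw [this]
    exact mul_le_mul_of_nonneg_right a (by positivity)
  have hj2b : ∀ x, |j2 x| ≤ (2 * c + 12 * c ^ 2 * x ^ 2) * j x := fun x => by
    have hp := hpos x
    have a := hMs 0 (c * x ^ 2)
    have b := hM0 1 (c * x ^ 2)
    have a' := hMs 1 (c * x ^ 2)
    have b' := hM0 2 (c * x ^ 2)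
    simp only [zero_add, one_add_one_eq_two] at a a'
    -- In terms of the ratios, `j2 / j` is a polynomial; the constant `12` of the bound is `4` from
    -- the second moment plus `8` from the squared first moment.
    have key : j2 x = (-(M 2 (c * x ^ 2) / M 0 (c * x ^ 2)) * (4 * c ^ 2 * x ^ 2)
        - (M 1 (c * x ^ 2) / M 0 (c * x ^ 2)) * (2 * c)
        + 2 * (M 1 (c * x ^ 2) / M 0 (c * x ^ 2)) ^ 2 * (4 * c ^ 2 * x ^ 2)) * j x := by
      simp only [hj2, hN2, hj]
      field_simp
      ring
    rw [key, abs_mul, abs_of_pos (hj0 x)]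
    refine mul_le_mul_of_nonneg_right ?_ (hj0 x).le
    set r1 := M 1 (c * x ^ 2) / M 0 (c * x ^ 2)
    set r2 := M 2 (c * x ^ 2) / M 0 (c * x ^ 2)
    have r10 : 0 ≤ r1 := by positivity
    have r20 : 0 ≤ r2 := by positivity
    have r11 : r1 ≤ 1 := (div_le_one hp).2 a
    have r21 : r2 ≤ 1 := (div_le_one hp).2 (a'.trans a)
    have hs : 0 ≤ c ^ 2 * x ^ 2 := by positivity
    have r12 : r1 ^ 2 ≤ 1 := pow_le_one₀ r10 r11
    rw [abs_le]
    constructor <;> nlinarith [mul_le_mul_of_nonneg_right r12 hs, mul_le_mul_of_nonneg_right r21 hs,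
      mul_le_mul_of_nonneg_right r11 hc.le, mul_nonneg r10 hc.le, mul_nonneg r20 hs,
      mul_nonneg (sq_nonneg r1) hs]
  have cj : Continuous j := continuous_iff_continuousAt.2 fun x => (hjd x).continuousAt
  have cj1 : Continuous j1 := continuous_iff_continuousAt.2 fun x => (hjd1 x).continuousAt
  have hcM : ∀ m, Continuous fun x : ℝ => M m (c * x ^ 2) := fun m =>
    continuous_iff_continuousAt.2 fun x => (hD m x).continuousAt
  have cj2 : Continuous j2 := by
    have hx : Continuous fun x : ℝ => 2 * c * x := by fun_prop
    refine Continuous.div ?_ (((hcM 0).pow 2).pow 2)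
      fun x => pow_ne_zero _ (pow_ne_zero _ (hpos x).ne')
    exact (((((hcM 2).mul hx).mul hx).add ((hcM 1).mul_const _)).neg.mul ((hcM 0).pow 2)).sub
      (((hcM 1).mul hx).neg.mul (((hcM 0).const_mul 2).mul ((hcM 1).mul hx)))
  have g0 := integrable_pow_mul_exp_neg_mul_sq (half_pos hc) 0
  have g1 := (integrable_pow_mul_exp_neg_mul_sq (half_pos hc) 1).norm
  have g2 := integrable_pow_mul_exp_neg_mul_sq (half_pos hc) 2
  have ij : Integrable j := by
    refine (g0.const_mul δ⁻¹).mono' cj.aestronglyMeasurable (Filter.Eventually.of_forall fun x => ?_)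
    rw [Real.norm_eq_abs, abs_of_pos (hj0 x), pow_zero, one_mul]
    exact hjb x
  have ij1 : Integrable j1 := by
    refine (g1.const_mul (2 * c * δ⁻¹)).mono' cj1.aestronglyMeasurable
      (Filter.Eventually.of_forall fun x => ?_)
    refine (hj1b x).trans ?_
    rw [Real.norm_eq_abs, abs_mul, pow_one, abs_of_pos (Real.exp_pos _)]
    calc 2 * c * |x| * j x ≤ 2 * c * |x| * (δ⁻¹ * Real.exp (-(c / 2) * x ^ 2)) :=
          mul_le_mul_of_nonneg_left (hjb x) (by positivity)
      _ = _ := by ring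
  have ij2 : Integrable j2 := by
    refine ((g0.const_mul (2 * c * δ⁻¹)).add (g2.const_mul (12 * c ^ 2 * δ⁻¹))).mono'
      cj2.aestronglyMeasurable (Filter.Eventually.of_forall fun x => ?_)
    refine (hj2b x).trans ?_
    calc (2 * c + 12 * c ^ 2 * x ^ 2) * j x
        ≤ (2 * c + 12 * c ^ 2 * x ^ 2) * (δ⁻¹ * Real.exp (-(c / 2) * x ^ 2)) :=
          mul_le_mul_of_nonneg_left (hjb x) (by positivity)
      _ = _ := by simp only [Pi.add_apply]; ring
  have hfun : (fun x : ℝ => ((mgf k Λ (c * x ^ 2) : ℝ) : ℂ)⁻¹) = fun x => ((j x : ℝ) : ℂ) := by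
    ext x; simp [hj, hW]
  rw [hfun]
  exact ⟨ij.ofReal, integrable_fourier_of_hasDerivAt_two (fun x => (hjd x).ofReal_comp)
    (fun x => (hjd1 x).ofReal_comp) ij.ofReal ij1.ofReal ij2.ofReal⟩

end Mixture

/-! ### Deconvolving a Gaussian mixture into the standard Gaussian -/

section Deconvolution

open scoped FourierTransform NNReal

variable {Θ : Type*} [MeasurableSpace Θ]

theorem measurable_gaussianPDFReal_mixture {v : Θ → ℝ≥0} (hv : Measurable v) (x : ℝ) :
    Measurable fun q : ℝ × Θ => gaussianPDFReal 0 (v q.2) (x - q.1) := by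
  simp only [gaussianPDFReal]
  fun_prop

theorem integrable_gaussianPDFReal_mixture (Λ : Measure Θ) [IsFiniteMeasure Λ] {v : Θ → ℝ≥0}
    (hv : Measurable v) (hv0 : ∀ θ, v θ ≠ 0) (x : ℝ) :
    Integrable (fun q : ℝ × Θ => gaussianPDFReal 0 (v q.2) (x - q.1)) (volume.prod Λ) := by
  rw [integrable_prod_iff' (measurable_gaussianPDFReal_mixture hv x).aestronglyMeasurable]
  refine ⟨Filter.Eventually.of_forall fun θ => (integrable_gaussianPDFReal 0 (v θ)).comp_sub_left x,
    (integrable_const (1 : ℝ)).congr (Filter.Eventually.of_forall fun θ => ?_)⟩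
  have : ∀ r, ‖gaussianPDFReal 0 (v θ) (x - r)‖ = gaussianPDFReal 0 (v θ) (x - r) := fun r =>
    Real.norm_of_nonneg (gaussianPDFReal_nonneg _ _ _)
  simp only [this]
  rw [integral_sub_left_eq_self (fun r => gaussianPDFReal 0 (v θ) r),
    integral_gaussianPDFReal_eq_one 0 (hv0 θ)]

theorem fourier_gaussianPDFReal_sub {v : ℝ≥0} (hv : v ≠ 0) (x w : ℝ) :
    𝓕 (fun r : ℝ => ((gaussianPDFReal 0 v (x - r) : ℝ) : ℂ)) w =
      Complex.exp (-(2 * Real.pi * x * w : ℝ) * Complex.I) *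
        ((Real.exp (-(2 * Real.pi ^ 2 * w ^ 2 * v)) : ℝ) : ℂ) := by
  have h := charFun_gaussianReal (μ := x) (v := v) (-(2 * Real.pi * w))
  rw [charFun_apply_real, integral_gaussianReal_eq_integral_smul hv] at h
  rw [Real.fourier_real_eq_integral_exp_smul]
  have e : ∀ r, gaussianPDFReal 0 v (x - r) = gaussianPDFReal x v r := fun r => by
    simp only [gaussianPDFReal]
    ring_nf
  calc _ = ∫ r, gaussianPDFReal x v r • Complex.exp ((-(2 * Real.pi * w) : ℝ) * r * Complex.I) := by
        refine integral_congr_ae (Filter.Eventually.of_forall fun r => ?_)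
        simp only [e, smul_eq_mul, Complex.real_smul]
        rw [mul_comm]
        congr 2
        push_cast
        ring
    _ = _ := by
        rw [h, Complex.ofReal_exp, ← Complex.exp_add]
        congr 1
        push_cast
        ring

/-- Taking the standard Gaussian factor out of `exp(-2π²w²v)` leaves `exp(2π²w²(1 - v))`, whose
average is a moment generating function of the `[0, 1)`-valued variable `1 - v`. The multiplier
leading back from the mixture to the standard Gaussian is thus its reciprocal. -/
theorem fourier_gaussianPDFReal_mixture (Λ : Measure Θ) [IsFiniteMeasure Λ] {v : Θ → ℝ≥0}
    (hv : Measurable v) (hv0 : ∀ θ, v θ ≠ 0) (x w : ℝ) :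
    𝓕 (fun r : ℝ => ((∫ θ, gaussianPDFReal 0 (v θ) (x - r) ∂Λ : ℝ) : ℂ)) w =
      Complex.exp (-(2 * Real.pi * x * w : ℝ) * Complex.I) *
        ((Real.exp (-(2 * Real.pi ^ 2 * w ^ 2)) *
          mgf (fun θ => 1 - (v θ : ℝ)) Λ (2 * Real.pi ^ 2 * w ^ 2) : ℝ) : ℂ) := by
  rw [Real.fourier_real_eq_integral_exp_smul]
  have hi := integrable_gaussianPDFReal_mixture Λ hv hv0 x
  have hi2 : Integrable (fun q : ℝ × Θ => Complex.exp ((-2 * Real.pi * q.1 * w : ℝ) * Complex.I) *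
      ((gaussianPDFReal 0 (v q.2) (x - q.1) : ℝ) : ℂ)) (volume.prod Λ) := by
    refine hi.ofReal.bdd_mul (c := 1) (by fun_prop) (Filter.Eventually.of_forall fun q => ?_)
    rw [Complex.norm_exp_ofReal_mul_I]
  calc _ = ∫ r : ℝ, ∫ θ, Complex.exp ((-2 * Real.pi * r * w : ℝ) * Complex.I) *
      ((gaussianPDFReal 0 (v θ) (x - r) : ℝ) : ℂ) ∂Λ := by
        refine integral_congr_ae (Filter.Eventually.of_forall fun r => ?_)
        simp only [smul_eq_mul]
        rw [integral_const_mul, integral_complex_ofReal]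
    _ = ∫ θ, (∫ r : ℝ, Complex.exp ((-2 * Real.pi * r * w : ℝ) * Complex.I) *
      ((gaussianPDFReal 0 (v θ) (x - r) : ℝ) : ℂ)) ∂Λ := integral_integral_swap hi2
    _ = ∫ θ, Complex.exp (-(2 * Real.pi * x * w : ℝ) * Complex.I) *
        ((Real.exp (-(2 * Real.pi ^ 2 * w ^ 2 * v θ)) : ℝ) : ℂ) ∂Λ := by
        refine integral_congr_ae (Filter.Eventually.of_forall fun θ => ?_)
        have := fourier_gaussianPDFReal_sub (hv0 θ) x w
        rw [Real.fourier_real_eq_integral_exp_smul] at this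
        exact this
    _ = _ := by
        rw [integral_const_mul, integral_complex_ofReal, mgf, ← integral_const_mul]
        congr 3
        ext θ
        rw [← Real.exp_add]
        ring_nf

/-- A Gaussian mixture with variances at most `1`, not concentrated near `1`, can be
deconvolved into the standard Gaussian density by an integrable function. -/
theorem exists_integrable_conv_eq_gaussianPDFReal (Λ : Measure Θ) [IsFiniteMeasure Λ] {v : Θ → ℝ≥0}
    (hv : Measurable v) (hv0 : ∀ θ, v θ ≠ 0) (hv1 : ∀ θ, v θ ≤ 1)
    (hΛ : Λ {θ | (v θ : ℝ) ≤ 1 / 2} ≠ 0) :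
    ∃ H : ℝ → ℂ, Integrable H ∧
      ∀ x, ∫ r, H r * ((∫ θ, gaussianPDFReal 0 (v θ) (x - r) ∂Λ : ℝ) : ℂ) =
        ((gaussianPDFReal 0 1 x : ℝ) : ℂ) := by
  have hk : Measurable fun θ => 1 - (v θ : ℝ) := by fun_prop
  have hk0 : ∀ θ, 0 ≤ 1 - (v θ : ℝ) := fun θ => sub_nonneg.2 (by exact_mod_cast hv1 θ)
  have hk1 : ∀ θ, 1 - (v θ : ℝ) ≤ 1 := fun θ => sub_le_self _ (v θ).coe_nonneg
  have hset : {θ | 1 / 2 ≤ 1 - (v θ : ℝ)} = {θ | (v θ : ℝ) ≤ 1 / 2} := by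
    ext θ
    constructor <;> intro h <;> simp only [Set.mem_ofPred_eq] at h ⊢ <;> linarith
  have hc : 0 < 2 * Real.pi ^ 2 := by positivity
  obtain ⟨hJ, hH⟩ := integrable_fourier_inv_mgf_sq Λ hk hk0 hk1 (by rwa [hset]) hc
  -- `H` is the transform of the reciprocal generating function. Duality moves the transform onto
  -- the mixture, where the generating function cancels and only a Gaussian integral remains.
  refine ⟨_, hH, fun x => ?_⟩
  have hQ : Integrable fun r => ((∫ θ, gaussianPDFReal 0 (v θ) (x - r) ∂Λ : ℝ) : ℂ) :=
    (integrable_gaussianPDFReal_mixture Λ hv hv0 x).integral_prod_left.ofReal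
  rw [integral_fourier_mul_eq hJ hQ]
  have hmgf : ∀ z, mgf (fun θ => 1 - (v θ : ℝ)) Λ z ≠ 0 := fun z => by
    refine (mgf_pos' ?_ ?_).ne'
    · rintro rfl
      simp at hΛ
    · simpa using integrable_pow_mul_exp_of_bounded Λ hk hk0 hk1 0 z
  have e : ∀ w, ((mgf (fun θ => 1 - (v θ : ℝ)) Λ (2 * Real.pi ^ 2 * w ^ 2) : ℝ) : ℂ)⁻¹ *
      𝓕 (fun r : ℝ => ((∫ θ, gaussianPDFReal 0 (v θ) (x - r) ∂Λ : ℝ) : ℂ)) w =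
      Complex.exp ((-2 * Real.pi * w * x : ℝ) * Complex.I) •
        Complex.exp (-Real.pi * ((2 * Real.pi : ℝ) : ℂ) * w ^ 2) := fun w => by
    rw [fourier_gaussianPDFReal_mixture Λ hv hv0]
    have := hmgf (2 * Real.pi ^ 2 * w ^ 2)
    rw [Complex.ofReal_mul (Real.exp _), smul_eq_mul]
    have h2 : ((mgf (fun θ => 1 - (v θ : ℝ)) Λ (2 * Real.pi ^ 2 * w ^ 2) : ℝ) : ℂ) ≠ 0 := by
      exact_mod_cast this
    rw [mul_comm, mul_assoc, mul_inv_cancel_right₀ h2, Complex.ofReal_exp]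
    congr 2 <;> push_cast <;> ring
  simp only [e]
  rw [← Real.fourier_real_eq_integral_exp_smul (fun w : ℝ =>
    Complex.exp (-Real.pi * ((2 * Real.pi : ℝ) : ℂ) * w ^ 2)), fourier_gaussian_pi (by
      rw [Complex.ofReal_re]; positivity)]
  simp only [gaussianPDFReal]
  have hs : (((2 * Real.pi : ℝ) : ℂ) ^ (1 / 2 : ℂ)) = ((√(2 * Real.pi) : ℝ) : ℂ) := by
    rw [Real.sqrt_eq_rpow, Complex.ofReal_cpow (by positivity)]
    push_cast
    rfl
  rw [hs]
  have hp : (Real.pi : ℂ) ≠ 0 := by exact_mod_cast Real.pi_ne_zero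
  push_cast
  rw [one_div, sub_zero, mul_one, mul_one]
  congr 2
  field_simp

end Deconvolution

/-! ### The first-order kernel as the derivative of a Gaussian mixture -/

section MixtureKernel

open scoped NNReal

/-- If the convolution of a measure with a Gaussian mixture as in
`exists_integrable_conv_eq_gaussianPDFReal` is constant, then so is its convolution with the
standard Gaussian density. -/
theorem integral_gaussianPDFReal_sub_eq_of_mixture {Θ : Type*} [MeasurableSpace Θ] (Λ : Measure Θ)
    [IsFiniteMeasure Λ] {v : Θ → ℝ≥0} (hv : Measurable v) (hv0 : ∀ θ, v θ ≠ 0)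
    (hv1 : ∀ θ, v θ ≤ 1) (hΛ : Λ {θ | (v θ : ℝ) ≤ 1 / 2} ≠ 0) (μ : Measure ℝ) [SFinite μ]
    (hint : ∀ s, Integrable (fun t => ∫ θ, gaussianPDFReal 0 (v θ) (t - s) ∂Λ) μ) {C : ℝ}
    (hC : ∀ s, ∫ t, ∫ θ, gaussianPDFReal 0 (v θ) (t - s) ∂Λ ∂μ = C) (s s' : ℝ) :
    ∫ t, gaussianPDFReal 0 1 (t - s) ∂μ = ∫ t, gaussianPDFReal 0 1 (t - s') ∂μ := by
  obtain ⟨H, hH, hHQ⟩ := exists_integrable_conv_eq_gaussianPDFReal Λ hv hv0 hv1 hΛ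
  set Q : ℝ → ℝ := fun r => ∫ θ, gaussianPDFReal 0 (v θ) r ∂Λ with hQ
  have hQm : StronglyMeasurable Q := by
    have hm : Measurable fun q : ℝ × Θ => gaussianPDFReal 0 (v q.2) q.1 := by
      simp only [gaussianPDFReal]
      fun_prop
    exact hm.stronglyMeasurable.integral_prod_right
  have hQ0 : ∀ r, 0 ≤ Q r := fun r => integral_nonneg fun θ => gaussianPDFReal_nonneg _ _ _
  -- Write the standard Gaussian as the convolution of `H` with `Q` and exchange integrals: the
  -- inner integral is the hypothesis at centre `s + r`, so equals `C` whatever `s` is.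
  have key : ∀ s, ((∫ t, gaussianPDFReal 0 1 (t - s) ∂μ : ℝ) : ℂ) = ∫ r, H r * (C : ℂ) := fun s => by
    have hi : Integrable (fun q : ℝ × ℝ => H q.2 * ((Q (q.1 - s - q.2) : ℝ) : ℂ))
        (μ.prod volume) := by
      have hm : AEStronglyMeasurable (fun q : ℝ × ℝ => H q.2 * ((Q (q.1 - s - q.2) : ℝ) : ℂ))
          (μ.prod volume) := by
        refine hH.aestronglyMeasurable.comp_snd.mul ?_
        exact (Complex.measurable_ofReal.comp (hQm.measurable.comp (by fun_prop))).aestronglyMeasurable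
      rw [integrable_prod_iff' hm]
      refine ⟨Filter.Eventually.of_forall fun r => ?_, ?_⟩
      · have := (hint (s + r)).ofReal (𝕜 := ℂ)
        simp only [← sub_sub] at this
        exact this.const_mul (H r)
      · refine (hH.norm.mul_const C).congr (Filter.Eventually.of_forall fun r => ?_)
        simp only [norm_mul, Complex.norm_real, Real.norm_of_nonneg (hQ0 _)]
        rw [integral_const_mul, ← hC (s + r)]
        simp only [← sub_sub, hQ]
    calc ((∫ t, gaussianPDFReal 0 1 (t - s) ∂μ : ℝ) : ℂ)
        = ∫ t, (∫ r, H r * ((Q (t - s - r) : ℝ) : ℂ)) ∂μ := by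
          rw [← integral_complex_ofReal]
          exact integral_congr_ae (Filter.Eventually.of_forall fun t => (hHQ (t - s)).symm)
      _ = ∫ r, ∫ t, H r * ((Q (t - s - r) : ℝ) : ℂ) ∂μ := integral_integral_swap hi
      _ = ∫ r, H r * (C : ℂ) := by
          refine integral_congr_ae (Filter.Eventually.of_forall fun r => ?_)
          simp only
          rw [integral_const_mul, integral_complex_ofReal, ← hC (s + r)]
          simp only [← sub_sub, hQ]
  exact_mod_cast (key s).trans (key s').symm

theorem abs_mul_abs_rpow_sub_two_le (p x : ℝ) : |x * |x| ^ (p - 2)| ≤ |x| ^ (p - 1) := by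
  rcases eq_or_ne x 0 with rfl | hx
  · simp only [zero_mul, abs_zero]
    positivity
  · rw [abs_mul, abs_of_nonneg (Real.rpow_nonneg (abs_nonneg x) _),
      show p - 1 = 1 + (p - 2) by ring, Real.rpow_add (abs_pos.2 hx), Real.rpow_one]

theorem integrableOn_mul_abs_rpow_mul_exp {p : ℝ} (hp : 1 ≤ p) (x y : ℝ) :
    IntegrableOn (fun r : ℝ => r * |r| ^ (p - 2) * Real.exp (-r ^ 2 / 2)) (Set.Ioc x y) := by
  have hc : Continuous fun r : ℝ => |r| ^ (p - 1) :=
    continuous_abs.rpow_const fun _ => Or.inr (by linarith)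
  refine Integrable.mono' (hc.integrableOn_Icc.mono_set Set.Ioc_subset_Icc_self)
    (by fun_prop) (Filter.Eventually.of_forall fun r => ?_)
  rw [norm_mul, Real.norm_eq_abs, Real.norm_of_nonneg (Real.exp_pos _).le]
  refine (mul_le_of_le_one_right (abs_nonneg _) ?_).trans (abs_mul_abs_rpow_sub_two_le p r)
  rw [Real.exp_le_one_iff]
  nlinarith [sq_nonneg r]

/-- This is the Gamma integral in `l`, convergent at `0` because `p < 2`; it represents `|r|^(p-2)
exp(-r²/2)` as a superposition of Gaussians of variance `1 / (1 + l)`. -/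
theorem integral_rpow_mul_exp_neg_sq {p : ℝ} (hp2 : p < 2) {r : ℝ} (hr : r ≠ 0) :
    IntegrableOn (fun l : ℝ => l ^ (-p / 2) * Real.exp (-(1 + l) * r ^ 2 / 2)) (Set.Ioi 0) ∧
    ∫ l in Set.Ioi 0, l ^ (-p / 2) * Real.exp (-(1 + l) * r ^ 2 / 2) =
      2 ^ (1 - p / 2) * Real.Gamma (1 - p / 2) * (|r| ^ (p - 2) * Real.exp (-r ^ 2 / 2)) := by
  have ha : 0 < 1 - p / 2 := by linarith
  have hr2 : 0 < r ^ 2 / 2 := by positivity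
  have h := Real.integral_rpow_mul_exp_neg_mul_Ioi ha hr2
  have hpow : (1 / (r ^ 2 / 2)) ^ (1 - p / 2) = 2 ^ (1 - p / 2) * |r| ^ (p - 2) := by
    rw [one_div_div, Real.div_rpow (by norm_num) (by positivity), ← sq_abs, ← Real.rpow_natCast,
      ← Real.rpow_mul (abs_nonneg r), div_eq_mul_inv, ← Real.rpow_neg (abs_nonneg r)]
    congr 2
    push_cast
    ring
  have e : ∀ l : ℝ, l ^ (-p / 2) * Real.exp (-(1 + l) * r ^ 2 / 2) =
      l ^ (1 - p / 2 - 1) * Real.exp (-(r ^ 2 / 2 * l)) * Real.exp (-r ^ 2 / 2) := fun l => by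
    rw [mul_assoc, ← Real.exp_add]
    congr 2 <;> ring
  simp only [e]
  have hi : IntegrableOn (fun l : ℝ => l ^ (1 - p / 2 - 1) * Real.exp (-(r ^ 2 / 2 * l)))
      (Set.Ioi 0) := by
    refine not_imp_comm.1 integral_undef ?_
    rw [h]
    have := Real.Gamma_pos_of_pos ha
    positivity
  refine ⟨hi.mul_const _, ?_⟩
  rw [integral_mul_const, h, hpow]
  ring

theorem integral_mul_exp_neg_sq {b : ℝ} (hb : b ≠ 0) (x y : ℝ) :
    ∫ r in x..y, r * Real.exp (-b * r ^ 2 / 2) =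
      b⁻¹ * Real.exp (-b * x ^ 2 / 2) - b⁻¹ * Real.exp (-b * y ^ 2 / 2) := by
  have hd : ∀ r : ℝ, HasDerivAt (fun r : ℝ => -(b⁻¹ * Real.exp (-b * r ^ 2 / 2)))
      (r * Real.exp (-b * r ^ 2 / 2)) r := fun r => by
    have h1 : HasDerivAt (fun r : ℝ => -b * r ^ 2 / 2) (-b * r) r := by
      refine (((hasDerivAt_pow 2 r).const_mul (-b)).div_const 2).congr_deriv ?_
      simp only [Nat.cast_ofNat, Nat.add_one_sub_one, pow_one]
      ring
    refine (h1.exp.const_mul b⁻¹).neg.congr_deriv ?_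
    field_simp
  rw [intervalIntegral.integral_eq_sub_of_hasDerivAt (fun r _ => hd r)
    (Continuous.intervalIntegrable (by fun_prop) _ _)]
  ring

/-- The kernel `r |r|^(p-2) exp(-r²/2)` is, up to a factor, the derivative of a Gaussian mixture. -/
theorem exists_mixture_integral_kernel {p : ℝ} (hp1 : 1 ≤ p) (hp2 : p < 2) :
    ∃ (Λ : Measure ℝ) (v : ℝ → ℝ≥0) (c : ℝ), IsFiniteMeasure Λ ∧ Measurable v ∧ (∀ l, v l ≠ 0) ∧
      (∀ l, v l ≤ 1) ∧ Λ {l | (v l : ℝ) ≤ 1 / 2} ≠ 0 ∧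
      (∀ x, Integrable (fun l => gaussianPDFReal 0 (v l) x) Λ) ∧
      ∀ x y, x ≤ y → c * ∫ r in x..y, r * |r| ^ (p - 2) * Real.exp (-r ^ 2 / 2) =
        ∫ l, gaussianPDFReal 0 (v l) x ∂Λ - ∫ l, gaussianPDFReal 0 (v l) y ∂Λ := by
  -- The factors `√(2π)` and `(1 + l)^(-1/2)` undo the normalisation of the Gaussian density; `(1 +
  -- l)⁻¹` cancels the factor produced by differentiating `exp(-(1 + l) x²/2)`.
  set w : ℝ → ℝ := fun l => √(2 * Real.pi) * (l ^ (-p / 2) * ((1 + l)⁻¹ * (√(1 + l))⁻¹)) with hw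
  have hwm : Measurable w := by fun_prop
  have hw0 : ∀ l ∈ Set.Ioi (0 : ℝ), 0 < w l := fun l (hl : 0 < l) => by positivity
  -- The norm keeps `0 < v ≤ 1` for every real `l`, although the mixing measure only charges `l >
  -- 0`.
  set v : ℝ → ℝ≥0 := fun l => (1 + ‖l‖₊)⁻¹ with hv
  have hvl : ∀ l ∈ Set.Ioi (0 : ℝ), (v l : ℝ) = (1 + l)⁻¹ := fun l (hl : 0 < l) => by
    simp [hv, abs_of_pos hl]
  have hwb : IntegrableOn (fun l : ℝ => l ^ (-p / 2) * (1 + l)⁻¹) (Set.Ioi 0) := by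
    rw [← Set.Ioc_union_Ioi_eq_Ioi (zero_le_one (α := ℝ))]
    have h1 : IntegrableOn (fun l : ℝ => l ^ (-p / 2)) (Set.Ioc 0 1) := by
      rw [← intervalIntegrable_iff_integrableOn_Ioc_of_le zero_le_one]
      exact intervalIntegral.intervalIntegrable_rpow' (by linarith)
    have h2 : IntegrableOn (fun l : ℝ => l ^ (-p / 2 - 1)) (Set.Ioi 1) :=
      integrableOn_Ioi_rpow_of_lt (by linarith) one_pos
    refine IntegrableOn.union ?_ ?_
    · refine h1.mono' (by fun_prop) ?_
      filter_upwards [ae_restrict_mem measurableSet_Ioc] with l hl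
      have hl0 : 0 < l := hl.1
      rw [Real.norm_of_nonneg (by positivity)]
      exact mul_le_of_le_one_right (by positivity) (inv_le_one_of_one_le₀ (by linarith))
    · refine h2.mono' (by fun_prop) ?_
      filter_upwards [ae_restrict_mem measurableSet_Ioi] with l hl
      have hl0 : 0 < l := lt_trans one_pos hl
      rw [Real.norm_of_nonneg (by positivity), Real.rpow_sub hl0, Real.rpow_one, div_eq_mul_inv]
      exact mul_le_mul_of_nonneg_left (inv_anti₀ hl0 (by linarith)) (by positivity)
  have hwi : IntegrableOn w (Set.Ioi 0) := by
    refine (hwb.const_mul √(2 * Real.pi)).mono' hwm.aestronglyMeasurable ?_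
    filter_upwards [ae_restrict_mem measurableSet_Ioi] with l hl
    have hl0 : 0 < l := hl
    rw [Real.norm_of_nonneg (hw0 l hl0).le]
    have a2 : (√(1 + l))⁻¹ ≤ 1 := inv_le_one_of_one_le₀ (Real.one_le_sqrt.2 (by linarith))
    refine mul_le_mul_of_nonneg_left ?_ (by positivity)
    exact mul_le_mul_of_nonneg_left (mul_le_of_le_one_right (by positivity) a2) (by positivity)
  set Λ : Measure ℝ := (volume.restrict (Set.Ioi 0)).withDensity fun l => ENNReal.ofReal (w l) with hΛ
  have hwQ : ∀ x, ∀ l ∈ Set.Ioi (0 : ℝ), (ENNReal.ofReal (w l)).toReal • gaussianPDFReal 0 (v l) x =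
      l ^ (-p / 2) * ((1 + l)⁻¹ * Real.exp (-(1 + l) * x ^ 2 / 2)) := fun x l hl => by
    have hl0 : 0 < l := hl
    rw [ENNReal.toReal_ofReal (hw0 l hl).le]
    simp only [smul_eq_mul, gaussianPDFReal, hvl l hl, hw]
    have h1 : 0 < 1 + l := by linarith
    rw [Real.sqrt_mul (by positivity) (1 + l)⁻¹, Real.sqrt_inv]
    have h2 : -(x - 0) ^ 2 / (2 * (1 + l)⁻¹) = -(1 + l) * x ^ 2 / 2 := by field_simp; ring
    rw [h2]
    have h3 : 0 < √(1 + l) := Real.sqrt_pos.2 h1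
    have h4 : 0 < √(2 * Real.pi) := by positivity
    field_simp
  have hQ : ∀ x, ∫ l, gaussianPDFReal 0 (v l) x ∂Λ =
      ∫ l in Set.Ioi 0, l ^ (-p / 2) * ((1 + l)⁻¹ * Real.exp (-(1 + l) * x ^ 2 / 2)) := fun x => by
    rw [hΛ, integral_withDensity_eq_integral_toReal_smul (by fun_prop)
      (Filter.Eventually.of_forall fun _ => ENNReal.ofReal_lt_top)]
    exact setIntegral_congr_fun measurableSet_Ioi (hwQ x)
  have hQi : ∀ x, IntegrableOn
      (fun l : ℝ => l ^ (-p / 2) * ((1 + l)⁻¹ * Real.exp (-(1 + l) * x ^ 2 / 2))) (Set.Ioi 0) := fun x => by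
    have hm : Measurable fun l : ℝ =>
      l ^ (-p / 2) * ((1 + l)⁻¹ * Real.exp (-(1 + l) * x ^ 2 / 2)) := by fun_prop
    refine hwb.mono' hm.aestronglyMeasurable ?_
    filter_upwards [ae_restrict_mem measurableSet_Ioi] with l hl
    have hl0 : 0 < l := hl
    rw [Real.norm_of_nonneg (by positivity)]
    refine mul_le_mul_of_nonneg_left (mul_le_of_le_one_right (by positivity) ?_) (by positivity)
    rw [Real.exp_le_one_iff]
    have : 0 ≤ (1 + l) * x ^ 2 := by positivity
    linarith
  refine ⟨Λ, v, 2 ^ (1 - p / 2) * Real.Gamma (1 - p / 2), ?_, ?_, ?_, ?_, ?_, ?_, ?_⟩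
  · exact isFiniteMeasure_withDensity_ofReal hwi.2
  · exact (measurable_const.add measurable_nnnorm).inv
  · intro l
    simp only [hv]
    positivity
  · intro l
    exact inv_le_one_of_one_le₀ (by simp)
  · rw [hΛ, Ne, withDensity_apply_eq_zero (by fun_prop)]
    -- For `l > 1` the variance `1 / (1 + l)` is at most `1/2`, and the density `w` is positive on
    -- `(1, 2]`.
    refine (lt_of_lt_of_le ?_ (measure_mono (s := Set.Ioc 1 2) ?_)).ne'
    · rw [Measure.restrict_apply measurableSet_Ioc, Set.inter_eq_left.2
        (show Set.Ioc (1 : ℝ) 2 ⊆ Set.Ioi 0 from fun l hl => lt_trans one_pos hl.1)]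
      simp
    · intro l hl
      have hl1 : 1 < l := hl.1
      have hl0 : (0 : ℝ) < l := by linarith
      refine ⟨(ENNReal.ofReal_pos.2 (hw0 l hl0)).ne', ?_⟩
      simp only [Set.mem_ofPred_eq]
      rw [hvl l hl0, one_div]
      exact inv_anti₀ two_pos (by linarith)
  · intro x
    rw [hΛ, integrable_withDensity_iff_integrable_smul' (by fun_prop)
      (Filter.Eventually.of_forall fun _ => ENNReal.ofReal_lt_top)]
    exact (integrableOn_congr_fun (hwQ x) measurableSet_Ioi).2 (hQi x)
  intro x y hxy
  rw [hQ, hQ, ← integral_sub (hQi x) (hQi y)]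
  have hi : Integrable (fun q : ℝ × ℝ => q.1 ^ (-p / 2) * (q.2 * Real.exp (-(1 + q.1) * q.2 ^ 2 / 2)))
      ((volume.restrict (Set.Ioi 0)).prod (volume.restrict (Set.Ioc x y))) := by
    have hm : Measurable fun q : ℝ × ℝ =>
      q.1 ^ (-p / 2) * (q.2 * Real.exp (-(1 + q.1) * q.2 ^ 2 / 2)) := by fun_prop
    rw [integrable_prod_iff' hm.aestronglyMeasurable]
    constructor
    · refine Filter.Eventually.of_forall fun r => ?_
      rcases eq_or_ne r 0 with rfl | hr
      · simp
      · refine ((integral_rpow_mul_exp_neg_sq hp2 hr).1.const_mul r).congr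
          (Filter.Eventually.of_forall fun l => ?_)
        simp only
        ring
    · refine ((integrableOn_mul_abs_rpow_mul_exp hp1 x y).norm.const_mul
        (2 ^ (1 - p / 2) * Real.Gamma (1 - p / 2))).congr (Filter.Eventually.of_forall fun r => ?_)
      have e : ∫ l in Set.Ioi (0 : ℝ), ‖l ^ (-p / 2) * (r * Real.exp (-(1 + l) * r ^ 2 / 2))‖ =
          ∫ l in Set.Ioi (0 : ℝ), |r| * (l ^ (-p / 2) * Real.exp (-(1 + l) * r ^ 2 / 2)) := by
        refine setIntegral_congr_fun measurableSet_Ioi fun l hl => ?_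
        have hl0 : 0 < l := hl
        rw [norm_mul, norm_mul, Real.norm_of_nonneg (Real.rpow_nonneg hl0.le _), Real.norm_eq_abs,
          Real.norm_of_nonneg (Real.exp_pos _).le]
        ring
      simp only
      rw [e, integral_const_mul]
      rcases eq_or_ne r 0 with rfl | hr
      · simp
      · rw [(integral_rpow_mul_exp_neg_sq hp2 hr).2, norm_mul, norm_mul,
          Real.norm_of_nonneg (Real.exp_pos _).le, Real.norm_eq_abs,
          Real.norm_of_nonneg (Real.rpow_nonneg (abs_nonneg r) _)]
        ring
  calc _ = ∫ r in Set.Ioc x y, ∫ l in Set.Ioi 0,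
        l ^ (-p / 2) * (r * Real.exp (-(1 + l) * r ^ 2 / 2)) := by
        rw [intervalIntegral.integral_of_le hxy, ← integral_const_mul]
        refine integral_congr_ae (Filter.Eventually.of_forall fun r => ?_)
        rcases eq_or_ne r 0 with rfl | hr
        · simp
        · have e : ∀ l : ℝ, l ^ (-p / 2) * (r * Real.exp (-(1 + l) * r ^ 2 / 2)) =
              r * (l ^ (-p / 2) * Real.exp (-(1 + l) * r ^ 2 / 2)) := fun l => by ring
          simp only [e]
          rw [integral_const_mul, (integral_rpow_mul_exp_neg_sq hp2 hr).2]
          ring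
    _ = ∫ l in Set.Ioi 0, ∫ r in Set.Ioc x y,
        l ^ (-p / 2) * (r * Real.exp (-(1 + l) * r ^ 2 / 2)) := (integral_integral_swap hi).symm
    _ = _ := by
        refine setIntegral_congr_fun measurableSet_Ioi fun l hl => ?_
        have hl0 : 0 < l := hl
        rw [integral_const_mul, ← intervalIntegral.integral_of_le hxy,
          integral_mul_exp_neg_sq (by positivity)]
        ring

end MixtureKernel

/-! ### Estimates for powers and exponentials -/

theorem hasDerivAt_abs_rpow_of_ne {p x : ℝ} (hx : x ≠ 0) :
    HasDerivAt (fun x : ℝ => |x| ^ p) (p * (x * |x| ^ (p - 2))) x := by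
  have h := (hasDerivAt_abs hx).rpow_const (p := p) (Or.inl (abs_ne_zero.2 hx))
  refine h.congr_deriv ?_
  have : |x| ^ (p - 1) = |x| * |x| ^ (p - 2) := by
    rw [show p - 1 = 1 + (p - 2) by ring, Real.rpow_add (abs_pos.2 hx), Real.rpow_one]
  rw [this, ← mul_assoc, mul_right_comm _ p, sign_mul_abs]
  ring

theorem abs_abs_rpow_sub_abs_rpow_le {p : ℝ} (hp : 1 ≤ p) {R u v : ℝ} (hu : |u| ≤ R)
    (hv : |v| ≤ R) : |(|u| ^ p - |v| ^ p)| ≤ p * R ^ (p - 1) * |u - v| := by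
  have hR : 0 ≤ R := (abs_nonneg u).trans hu
  have h := (convex_Icc (0 : ℝ) R).norm_image_sub_le_of_norm_hasDerivWithin_le
    (f := fun x : ℝ => x ^ p) (f' := fun x => p * x ^ (p - 1)) (C := p * R ^ (p - 1))
    (x := |v|) (y := |u|)
    (fun x _ => (Real.hasDerivAt_rpow_const (Or.inr hp)).hasDerivWithinAt)
    (fun x hx => by
      rw [Real.norm_of_nonneg (mul_nonneg (by linarith) (Real.rpow_nonneg hx.1 _))]
      exact mul_le_mul_of_nonneg_left (Real.rpow_le_rpow hx.1 hx.2 (by linarith)) (by linarith))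
    ⟨abs_nonneg v, hv⟩ ⟨abs_nonneg u, hu⟩
  refine h.trans (mul_le_mul_of_nonneg_left (abs_abs_sub_abs_le u v) ?_)
  exact mul_nonneg (by linarith) (Real.rpow_nonneg hR _)

theorem rpow_le_one_add_sq {p r : ℝ} (hp0 : 0 ≤ p) (hp2 : p ≤ 2) (hr : 0 ≤ r) :
    r ^ p ≤ 1 + r ^ 2 := by
  rcases le_total r 1 with h | h
  · have := Real.rpow_le_one hr h hp0
    nlinarith [sq_nonneg r]
  · have := Real.rpow_le_rpow_of_exponent_le h hp2
    rw [Real.rpow_two] at this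
    linarith

theorem integrable_exp_mul_abs {ν : Measure ℝ}
    (hν : ∀ s, Integrable (fun t => Real.exp (s * t)) ν) (K : ℝ) :
    Integrable (fun t => Real.exp (K * |t|)) ν := by
  refine ((hν K).add (hν (-K))).mono' (by fun_prop) (Filter.Eventually.of_forall fun t => ?_)
  rw [Real.norm_of_nonneg (Real.exp_pos _).le, Pi.add_apply]
  rcases abs_cases t with ⟨h, _⟩ | ⟨h, _⟩
  · rw [h]
    linarith [Real.exp_pos (-K * t)]
  · rw [h, mul_neg, ← neg_mul]
    linarith [Real.exp_pos (K * t)]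

/-! ### The first-order condition of the scalar problem -/

section FirstOrder

variable {ν : Measure ℝ} {p : ℝ}

theorem abs_rpow_mul_exp_le (hp1 : 1 ≤ p) (hp2 : p ≤ 2) {K s e : ℝ} (hs : |s| + 1 ≤ K)
    (he : |e| ≤ 1) (t : ℝ) :
    |t - s - e| ^ p * Real.exp (t * s - s ^ 2 / 2) ≤
      2 * Real.exp (2 * K) * Real.exp ((K + 2) * |t|) := by
  have h1 : |t - s - e| ≤ |t| + K := by
    calc |t - s - e| ≤ |t - s| + |e| := abs_sub _ _
      _ ≤ |t| + |s| + |e| := by gcongr; exact abs_sub _ _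
      _ ≤ _ := by linarith
  have hK : 0 ≤ K := by linarith [abs_nonneg s]
  have h2 : |t - s - e| ^ p ≤ Real.exp (2 * (|t| + K)) := by
    have a := rpow_le_one_add_sq (by linarith) hp2 (abs_nonneg (t - s - e))
    have b := Real.add_one_le_exp (|t| + K)
    have c : Real.exp (2 * (|t| + K)) = Real.exp (|t| + K) ^ 2 := by
      rw [← Real.exp_nat_mul]; norm_num
    rw [c]
    nlinarith [abs_nonneg (t - s - e), abs_nonneg t]
  have h3 : t * s - s ^ 2 / 2 ≤ K * |t| := by
    have : t * s ≤ |t| * |s| := by rw [← abs_mul]; exact le_abs_self _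
    nlinarith [abs_nonneg t, abs_nonneg s, sq_nonneg s]
  calc |t - s - e| ^ p * Real.exp (t * s - s ^ 2 / 2)
      ≤ Real.exp (2 * (|t| + K)) * Real.exp (K * |t|) := by gcongr
    _ = 1 * Real.exp (2 * K) * Real.exp ((K + 2) * |t|) := by
        rw [one_mul, ← Real.exp_add, ← Real.exp_add]; ring_nf
    _ ≤ _ := by gcongr; norm_num

theorem abs_rpow_mul_exp_lipschitz (hp1 : 1 ≤ p) (hp2 : p ≤ 2) {K s e e' : ℝ} (hs : |s| + 1 ≤ K)
    (he : |e| ≤ 1) (he' : |e'| ≤ 1) (t : ℝ) :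
    |(|t - s - e| ^ p * Real.exp (t * s - s ^ 2 / 2) -
      |t - s - e'| ^ p * Real.exp (t * s - s ^ 2 / 2))| ≤
      2 * Real.exp (2 * K) * Real.exp ((K + 2) * |t|) * |e - e'| := by
  have h1 : ∀ e : ℝ, |e| ≤ 1 → |t - s - e| ≤ |t| + K := fun e he => by
    calc |t - s - e| ≤ |t - s| + |e| := abs_sub _ _
      _ ≤ |t| + |s| + |e| := by gcongr; exact abs_sub _ _
      _ ≤ _ := by linarith
  have hK : 1 ≤ K := by linarith [abs_nonneg s]
  have h2 := abs_abs_rpow_sub_abs_rpow_le hp1 (h1 e he) (h1 e' he')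
  have h4 : |t - s - e - (t - s - e')| = |e - e'| := by
    rw [← abs_neg]; ring_nf
  rw [h4] at h2
  have h5 : p * (|t| + K) ^ (p - 1) ≤ 2 * Real.exp (2 * (|t| + K)) := by
    have a : (|t| + K) ^ (p - 1) ≤ |t| + K := by
      have : 1 ≤ |t| + K := by linarith [abs_nonneg t]
      simpa using Real.rpow_le_rpow_of_exponent_le this (by linarith : p - 1 ≤ 1)
    have b := Real.add_one_le_exp (2 * (|t| + K))
    have := abs_nonneg t
    exact mul_le_mul hp2 (by linarith) (by positivity) (by norm_num)
  have h3 : t * s - s ^ 2 / 2 ≤ K * |t| := by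
    have : t * s ≤ |t| * |s| := by rw [← abs_mul]; exact le_abs_self _
    nlinarith [abs_nonneg t, abs_nonneg s, sq_nonneg s]
  rw [← sub_mul, abs_mul, abs_of_pos (Real.exp_pos _)]
  calc _ ≤ (2 * Real.exp (2 * (|t| + K)) * |e - e'|) * Real.exp (K * |t|) := by
        refine mul_le_mul (h2.trans ?_) (Real.exp_le_exp.2 h3) (Real.exp_pos _).le (by positivity)
        gcongr
    _ = 2 * (Real.exp (2 * (|t| + K)) * Real.exp (K * |t|)) * |e - e'| := by ring
    _ = 2 * (Real.exp (2 * K) * Real.exp ((K + 2) * |t|)) * |e - e'| := by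
        rw [← Real.exp_add, ← Real.exp_add]; ring_nf
    _ = _ := by ring

/-- First order condition, integrated over an interval of centres. -/
theorem integral_exp_mul_integral_kernel_eq_zero [SFinite ν] (hp1 : 1 ≤ p) (hp2 : p ≤ 2)
    (hν : ∀ s, Integrable (fun t => Real.exp (s * t)) ν)
    (h : ∀ s c, ∫ t, |t - s| ^ p * Real.exp (s * t) ∂ν ≤ ∫ t, |t - c| ^ p * Real.exp (s * t) ∂ν)
    {x y : ℝ} (hxy : x ≤ y) :
    ∫ t, Real.exp (t ^ 2 / 2) *
      (∫ r in (t - y)..(t - x), r * |r| ^ (p - 2) * Real.exp (-r ^ 2 / 2)) ∂ν = 0 := by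
  have hfin : IsFiniteMeasure ν := by
    have := hν 0
    simp only [zero_mul, Real.exp_zero] at this
    exact (integrable_const_iff_isFiniteMeasure one_ne_zero).1 this
  set m := ν.prod (volume.restrict (Set.Ioc x y)) with hm
  set K : ℝ := max |x| |y| + 1 with hK
  have hKs : ∀ s ∈ Set.Ioc x y, |s| + 1 ≤ K := fun s hs => by
    have := abs_le_max_abs_abs hs.1.le hs.2
    linarith
  have hms : ∀ᵐ q ∂m, q.2 ∈ Set.Ioc x y := by
    have : ∀ᵐ s ∂(volume.restrict (Set.Ioc x y)), s ∈ Set.Ioc x y :=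
      ae_restrict_mem measurableSet_Ioc
    exact Measure.quasiMeasurePreserving_snd.ae this
  -- The derivative of `|t - s|^p` may fail to exist at `t = s` when `p = 1`, and `ν` may have
  -- atoms. Integrating over an interval of centres makes the diagonal a null set.
  have hne : ∀ᵐ q ∂m, q.1 - q.2 ≠ 0 := by
    have hset : MeasurableSet {q : ℝ × ℝ | q.1 - q.2 = 0} :=
      measurableSet_eq_fun (by fun_prop) (by fun_prop)
    have : m {q : ℝ × ℝ | q.1 - q.2 = 0} = 0 := by
      rw [hm, Measure.measure_prod_null hset]
      refine Filter.Eventually.of_forall fun t => ?_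
      have : Prod.mk t ⁻¹' {q : ℝ × ℝ | q.1 - q.2 = 0} = {t} := by
        ext s; simp [sub_eq_zero, eq_comm]
      simp only [this]
      simp
    exact (measure_eq_zero_iff_ae_notMem.1 this)
  have hbound : Integrable
      (fun q : ℝ × ℝ => 2 * Real.exp (2 * K) * Real.exp ((K + 2) * |q.1|)) m :=
    ((integrable_exp_mul_abs hν (K + 2)).const_mul (2 * Real.exp (2 * K))).comp_fst _
  -- All centres are displaced by the same `e`. The extra factor `exp(-s²/2)` does not affect the
  -- minimisers and turns the tilt into `exp(t²/2) exp(-(t - s)²/2)`, a function of `t - s` up to a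
  -- weight in `t`.
  set F : ℝ → ℝ × ℝ → ℝ := fun e q =>
    |q.1 - q.2 - e| ^ p * Real.exp (q.1 * q.2 - q.2 ^ 2 / 2) with hF
  have hFm : ∀ e, AEStronglyMeasurable (F e) m := fun e => by
    have : Measurable (F e) := by simp only [hF]; fun_prop
    exact this.aestronglyMeasurable
  have hFi : ∀ e, |e| ≤ 1 → Integrable (F e) m := fun e he => by
    refine hbound.mono' (hFm e) ?_
    filter_upwards [hms] with q hq
    rw [Real.norm_of_nonneg (by positivity)]
    exact abs_rpow_mul_exp_le hp1 hp2 (hKs _ hq) he q.1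
  set F' : ℝ × ℝ → ℝ := fun q => -(p * ((q.1 - q.2) * |q.1 - q.2| ^ (p - 2))) *
    Real.exp (q.1 * q.2 - q.2 ^ 2 / 2) with hF'
  have hd := hasDerivAt_integral_of_dominated_loc_of_lip (F := F) (F' := F') (x₀ := (0 : ℝ))
    (μ := m) (s := Metric.closedBall 0 1)
    (bound := fun q : ℝ × ℝ => 2 * Real.exp (2 * K) * Real.exp ((K + 2) * |q.1|))
    (Metric.closedBall_mem_nhds 0 one_pos) (Filter.Eventually.of_forall hFm) (hFi 0 (by simp))
    (by
      have : Measurable F' := by simp only [hF']; fun_prop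
      exact this.aestronglyMeasurable)
    (by
      filter_upwards [hms] with q hq
      refine LipschitzOnWith.of_dist_le_mul fun e he e' he' => ?_
      rw [Real.coe_nnabs, abs_of_nonneg (by positivity), Real.dist_eq, Real.dist_eq]
      refine abs_rpow_mul_exp_lipschitz hp1 hp2 (hKs _ hq) ?_ ?_ q.1
      · simpa using he
      · simpa using he')
    hbound
    (by
      filter_upwards [hne] with q hq
      have a : HasDerivAt (fun e : ℝ => q.1 - q.2 - e) (-1) 0 := by
        simpa using (hasDerivAt_id (0 : ℝ)).const_sub (q.1 - q.2)
      have b := hasDerivAt_abs_rpow_of_ne (p := p) hq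
      rw [← sub_zero (q.1 - q.2)] at b
      have c := (b.comp (0 : ℝ) a).mul_const (Real.exp (q.1 * q.2 - q.2 ^ 2 / 2))
      refine c.congr_deriv ?_
      simp only [hF', sub_zero]
      ring)
  have hmin : IsLocalMin (fun e => ∫ q, F e q ∂m) 0 := by
    filter_upwards [Metric.closedBall_mem_nhds (0 : ℝ) one_pos] with e he
    have he1 : |e| ≤ 1 := by simpa using he
    rw [hm, integral_prod_symm _ (hFi 0 (by simp)), integral_prod_symm _ (hFi e he1)]
    refine integral_mono (hFi 0 (by simp)).integral_prod_right (hFi e he1).integral_prod_right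
      fun s => ?_
    have e1 : ∀ e t, F e (t, s) = Real.exp (-s ^ 2 / 2) * (|t - (s + e)| ^ p * Real.exp (s * t)) :=
      fun e t => by
        simp only [hF, ← sub_sub]
        rw [mul_left_comm, ← Real.exp_add]
        ring_nf
    simp only [e1, integral_const_mul, add_zero]
    exact mul_le_mul_of_nonneg_left (h s (s + e)) (Real.exp_pos _).le
  have h0 := hmin.hasDerivAt_eq_zero hd.2
  rw [hm, integral_prod _ hd.1] at h0
  have e2 : ∀ t, ∫ s in Set.Ioc x y, F' (t, s) = -p * (Real.exp (t ^ 2 / 2) *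
      ∫ r in (t - y)..(t - x), r * |r| ^ (p - 2) * Real.exp (-r ^ 2 / 2)) := fun t => by
    rw [← intervalIntegral.integral_comp_sub_left
      (fun r => r * |r| ^ (p - 2) * Real.exp (-r ^ 2 / 2)), intervalIntegral.integral_of_le hxy,
      ← mul_assoc, ← integral_const_mul]
    refine integral_congr_ae (Filter.Eventually.of_forall fun s => ?_)
    have e3 : Real.exp (t * s - s ^ 2 / 2) = Real.exp (t ^ 2 / 2) * Real.exp (-(t - s) ^ 2 / 2) := by
      rw [← Real.exp_add]; ring_nf
    simp only [hF', e3]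
    ring
  simp only [e2, integral_const_mul] at h0
  exact (mul_eq_zero.1 h0).resolve_left (by linarith)

end FirstOrder

/-! ### The scalar problem forces a Gaussian Laplace transform -/

section OneDim

variable {ν : Measure ℝ} {p : ℝ}

/-- At `p = 2`, where the Gamma integral diverges, the kernel is `r exp(-r²/2)` and integrates
explicitly, so no deconvolution is needed. -/
theorem integral_exp_of_minimizer_id_of_eq_two [SFinite ν]
    (hν : ∀ s, Integrable (fun t => Real.exp (s * t)) ν)
    (h : ∀ s c, ∫ t, |t - s| ^ (2 : ℝ) * Real.exp (s * t) ∂ν ≤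
      ∫ t, |t - c| ^ (2 : ℝ) * Real.exp (s * t) ∂ν) {x y : ℝ} (hxy : x ≤ y) :
    ∫ t, Real.exp (x * t - x ^ 2 / 2) ∂ν = ∫ t, Real.exp (y * t - y ^ 2 / 2) ∂ν := by
  have h0 := integral_exp_mul_integral_kernel_eq_zero one_le_two le_rfl hν h hxy
  have e : ∀ t, Real.exp (t ^ 2 / 2) *
      (∫ r in (t - y)..(t - x), r * |r| ^ ((2 : ℝ) - 2) * Real.exp (-r ^ 2 / 2)) =
      Real.exp (y * t - y ^ 2 / 2) - Real.exp (x * t - x ^ 2 / 2) := fun t => by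
    have := integral_mul_exp_neg_sq one_ne_zero (t - y) (t - x)
    simp only [neg_mul, one_mul, inv_one] at this
    simp only [sub_self, Real.rpow_zero, mul_one]
    rw [this, mul_sub, ← Real.exp_add, ← Real.exp_add]
    ring_nf
  have hi : ∀ s, Integrable (fun t => Real.exp (s * t - s ^ 2 / 2)) ν := fun s => by
    simp only [sub_eq_add_neg, Real.exp_add]
    exact (hν s).mul_const _
  simp only [e] at h0
  rw [integral_sub (hi y) (hi x)] at h0
  linarith

/-- The first-order condition makes the convolution of `exp(t²/2) ν(dt)` with the mixture `Q`
constant. Deconvolution transfers this to the standard Gaussian, and `exp(t²/2) exp(-(t - s)²/2) =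
exp(s t - s²/2)`. -/
theorem integral_exp_of_minimizer_id_of_lt_two [SFinite ν] (hp1 : 1 ≤ p) (hp2 : p < 2)
    (hν : ∀ s, Integrable (fun t => Real.exp (s * t)) ν)
    (h : ∀ s c, ∫ t, |t - s| ^ p * Real.exp (s * t) ∂ν ≤ ∫ t, |t - c| ^ p * Real.exp (s * t) ∂ν)
    (x y : ℝ) :
    ∫ t, Real.exp (x * t - x ^ 2 / 2) ∂ν = ∫ t, Real.exp (y * t - y ^ 2 / 2) ∂ν := by
  obtain ⟨Λ, v, c, hΛf, hv, hv0, hv1, hΛ, hΛi, hker⟩ := exists_mixture_integral_kernel hp1 hp2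
  set Q : ℝ → ℝ := fun r => ∫ l, gaussianPDFReal 0 (v l) r ∂Λ with hQ
  have hQm : Measurable Q := by
    have hm : Measurable fun q : ℝ × ℝ => gaussianPDFReal 0 (v q.2) q.1 := by
      simp only [gaussianPDFReal]
      fun_prop
    exact hm.stronglyMeasurable.integral_prod_right.measurable
  have hQ0 : ∀ r, 0 ≤ Q r := fun r => integral_nonneg fun θ => gaussianPDFReal_nonneg _ _ _
  -- Variances at most `1` give `Q` the decay needed to compensate the weight `exp(t²/2)`, under
  -- which `ν` may become infinite.
  have hQb : ∀ r, Q r ≤ Q 0 * Real.exp (-r ^ 2 / 2) := fun r => by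
    simp only [hQ]
    rw [← integral_mul_const]
    refine integral_mono (hΛi r) ((hΛi 0).mul_const _) fun l => ?_
    simp only [gaussianPDFReal, sub_zero, ne_eq, OfNat.ofNat_ne_zero, not_false_eq_true, zero_pow,
      neg_zero, zero_div, Real.exp_zero, mul_one]
    refine mul_le_mul_of_nonneg_left (Real.exp_le_exp.2 ?_) (by positivity)
    have h1 : (v l : ℝ) ≤ 1 := by exact_mod_cast hv1 l
    have h2 : 0 < (v l : ℝ) := by exact_mod_cast pos_iff_ne_zero.2 (hv0 l)
    rw [neg_div, neg_div, neg_le_neg_iff]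
    exact div_le_div_of_nonneg_left (sq_nonneg r) (by positivity) (by linarith)
  have hQi : ∀ s, Integrable (fun t => Real.exp (t ^ 2 / 2) * Q (t - s)) ν := fun s => by
    refine ((hν s).const_mul (Q 0)).mono' (by fun_prop) (Filter.Eventually.of_forall fun t => ?_)
    rw [Real.norm_of_nonneg (mul_nonneg (Real.exp_pos _).le (hQ0 _))]
    calc Real.exp (t ^ 2 / 2) * Q (t - s)
        ≤ Real.exp (t ^ 2 / 2) * (Q 0 * Real.exp (-(t - s) ^ 2 / 2)) :=
          mul_le_mul_of_nonneg_left (hQb _) (Real.exp_pos _).le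
      _ = Q 0 * Real.exp (s * t - s ^ 2 / 2) := by
          rw [mul_left_comm, ← Real.exp_add]; ring_nf
      _ ≤ Q 0 * Real.exp (s * t) :=
          mul_le_mul_of_nonneg_left (Real.exp_le_exp.2 (by linarith [sq_nonneg s])) (hQ0 0)
  have hstep : ∀ x y, x ≤ y → ∫ t, Real.exp (t ^ 2 / 2) * Q (t - x) ∂ν =
      ∫ t, Real.exp (t ^ 2 / 2) * Q (t - y) ∂ν := fun x y hxy => by
    have h0 := integral_exp_mul_integral_kernel_eq_zero hp1 hp2.le hν h hxy
    have e : ∀ t, Real.exp (t ^ 2 / 2) * Q (t - y) - Real.exp (t ^ 2 / 2) * Q (t - x) =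
        c * (Real.exp (t ^ 2 / 2) *
        (∫ r in (t - y)..(t - x), r * |r| ^ (p - 2) * Real.exp (-r ^ 2 / 2))) := fun t => by
      rw [mul_left_comm, hker _ _ (by linarith), mul_sub]
    have h1 := integral_sub (hQi y) (hQi x)
    simp only [e] at h1
    rw [integral_const_mul, h0, mul_zero] at h1
    linarith
  have hconst : ∀ s, ∫ t, Real.exp (t ^ 2 / 2) * Q (t - s) ∂ν =
      ∫ t, Real.exp (t ^ 2 / 2) * Q (t - 0) ∂ν := fun s => by
    rcases le_total s 0 with hs | hs
    · exact hstep s 0 hs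
    · exact (hstep 0 s hs).symm
  set μ : Measure ℝ := ν.withDensity fun t => ENNReal.ofReal (Real.exp (t ^ 2 / 2)) with hμ
  have hint : ∀ f : ℝ → ℝ, ∫ t, f t ∂μ = ∫ t, Real.exp (t ^ 2 / 2) * f t ∂ν := fun f => by
    rw [hμ, integral_withDensity_eq_integral_toReal_smul (by fun_prop)
      (Filter.Eventually.of_forall fun _ => ENNReal.ofReal_lt_top)]
    simp only [ENNReal.toReal_ofReal (Real.exp_pos _).le, smul_eq_mul]
  have hmain := integral_gaussianPDFReal_sub_eq_of_mixture Λ hv hv0 hv1 hΛ μ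
    (fun s => by
      rw [hμ, integrable_withDensity_iff_integrable_smul' (by fun_prop)
        (Filter.Eventually.of_forall fun _ => ENNReal.ofReal_lt_top)]
      simp only [ENNReal.toReal_ofReal (Real.exp_pos _).le, smul_eq_mul]
      exact hQi s)
    (fun s => (hint _).trans (hconst s)) x y
  rw [hint, hint] at hmain
  have e : ∀ s t, Real.exp (t ^ 2 / 2) * gaussianPDFReal 0 1 (t - s) =
      (√(2 * Real.pi))⁻¹ * Real.exp (s * t - s ^ 2 / 2) := fun s t => by
    simp only [gaussianPDFReal, NNReal.coe_one, mul_one, sub_zero]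
    rw [mul_left_comm, ← Real.exp_add]
    ring_nf
  simp only [e, integral_const_mul] at hmain
  exact mul_left_cancel₀ (by positivity) hmain

/-- If for every `s` the point `s` minimises the `p`-th absolute deviation of the exponentially
tilted measure `exp(s t) ν(dt)`, then `ν` has the Laplace transform of a centred Gaussian. -/
theorem integral_exp_of_minimizer_id [SFinite ν] (hp1 : 1 ≤ p) (hp2 : p ≤ 2)
    (hν : ∀ s, Integrable (fun t => Real.exp (s * t)) ν)
    (h : ∀ s c, ∫ t, |t - s| ^ p * Real.exp (s * t) ∂ν ≤ ∫ t, |t - c| ^ p * Real.exp (s * t) ∂ν)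
    (s : ℝ) :
    ∫ t, Real.exp (s * t) ∂ν = Real.exp (s ^ 2 / 2) * ν.real Set.univ := by
  have key : ∫ t, Real.exp (s * t - s ^ 2 / 2) ∂ν =
      ∫ t, Real.exp (0 * t - 0 ^ 2 / 2) ∂ν := by
    rcases hp2.lt_or_eq with hp | rfl
    · exact integral_exp_of_minimizer_id_of_lt_two hp1 hp hν h s 0
    · rcases le_total s 0 with hs | hs
      · exact integral_exp_of_minimizer_id_of_eq_two hν h hs
      · exact (integral_exp_of_minimizer_id_of_eq_two hν h hs).symm
  simp only [sub_eq_add_neg (s * _), Real.exp_add, integral_mul_const] at key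
  have h1 : ∫ t, Real.exp (0 * t - 0 ^ 2 / 2) ∂ν = ν.real Set.univ := by simp
  rw [h1] at key
  rw [← key, mul_comm, mul_assoc, ← Real.exp_add]
  simp

/-- If for every `s` the point `a s + b` minimises the `p`-th absolute deviation of a random
variable under exponential tilting by `s`, then its Laplace transform is Gaussian. -/
theorem integral_exp_of_minimizer_affine {Ω : Type*} [MeasurableSpace Ω] {P : Measure Ω} [SFinite P]
    {T : Ω → ℝ} (hT : Measurable T) (hp1 : 1 ≤ p) (hp2 : p ≤ 2) {a b : ℝ} (ha : 0 < a)
    (hP : ∀ s, Integrable (fun ω => Real.exp (s * T ω)) P)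
    (h : ∀ s c, ∫ ω, |T ω - (a * s + b)| ^ p * Real.exp (s * T ω) ∂P ≤
      ∫ ω, |T ω - c| ^ p * Real.exp (s * T ω) ∂P) (s : ℝ) :
    ∫ ω, Real.exp (s * T ω) ∂P = Real.exp (a * s ^ 2 / 2 + b * s) * P.real Set.univ := by
  -- In the variable `(T - b) / √a`, with tilt parameter multiplied by `√a`, the minimiser `a s + b`
  -- becomes the tilt parameter itself.
  set q := √a with hq
  have hq0 : 0 < q := Real.sqrt_pos.2 ha
  have hqq : q ^ 2 = a := Real.sq_sqrt ha.le
  set U : Ω → ℝ := fun ω => (T ω - b) / q with hU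
  have hUm : Measurable U := by fun_prop
  have hTU : ∀ ω, T ω = q * U ω + b := fun ω => by simp only [hU]; field_simp; ring
  have hexp : ∀ s ω, Real.exp (s * U ω) = Real.exp (s / q * T ω) * Real.exp (-(s * b / q)) :=
    fun s ω => by
      rw [← Real.exp_add]
      simp only [hU]
      ring_nf
  have hmap : ∀ (f : ℝ → ℝ), Measurable f → ∫ t, f t ∂(P.map U) = ∫ ω, f (U ω) ∂P := fun f hf =>
    integral_map hUm.aemeasurable hf.aestronglyMeasurable
  have habs : ∀ s c ω, |U ω - c| ^ p * Real.exp (s * U ω) =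
      ((q ^ p)⁻¹ * Real.exp (-(s * b / q))) *
        (|T ω - (q * c + b)| ^ p * Real.exp (s / q * T ω)) := fun s c ω => by
    rw [hexp, hTU ω, show q * U ω + b - (q * c + b) = q * (U ω - c) by ring, abs_mul,
      abs_of_pos hq0, Real.mul_rpow hq0.le (abs_nonneg _)]
    have : 0 < q ^ p := by positivity
    field_simp
  have main := integral_exp_of_minimizer_id (ν := P.map U) hp1 hp2
    (fun s => by
      rw [integrable_map_measure (by fun_prop) hUm.aemeasurable]
      refine ((hP (s / q)).mul_const (Real.exp (-(s * b / q)))).congr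
        (Filter.Eventually.of_forall fun ω => ?_)
      exact (hexp s ω).symm)
    (fun s c => by
      rw [hmap _ (by fun_prop), hmap _ (by fun_prop)]
      simp only [habs, integral_const_mul]
      refine mul_le_mul_of_nonneg_left ?_ (by positivity)
      have := h (s / q) (q * c + b)
      rwa [show a * (s / q) + b = q * s + b by rw [← hqq]; field_simp] at this)
    (s * q)
  rw [hmap _ (by fun_prop), map_measureReal_apply hUm MeasurableSet.univ, Set.preimage_univ] at main
  simp only [hexp, integral_mul_const] at main
  rw [mul_div_cancel_right₀ s hq0.ne', show s * q * b / q = b * s by field_simp, mul_pow, hqq] at main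
  rw [Real.exp_add, mul_comm a, mul_right_comm, ← main, mul_assoc, ← Real.exp_add]
  simp

end OneDim

/-! ### Densities for the Gaussian channel -/

section Density

/-- The standard Gaussian measure on a finite-dimensional inner product space has a density
proportional to `exp (-‖z‖² / 2)`. -/
theorem exists_stdGaussian_eq_withDensity (E : Type*) [NormedAddCommGroup E] [InnerProductSpace ℝ E]
    [FiniteDimensional ℝ E] [MeasurableSpace E] [BorelSpace E] :
    ∃ C : ℝ, 0 < C ∧ stdGaussian E =
      (volume : Measure E).withDensity fun z => ENNReal.ofReal (C * Real.exp (-‖z‖ ^ 2 / 2)) := by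
  set I : ℝ := ∫ z : E, Real.exp (-‖z‖ ^ 2 / 2) with hI
  have hIe : I = (Real.pi / (1 / 2)) ^ ((Module.finrank ℝ E : ℝ) / 2) := by
    rw [← GaussianFourier.integral_rexp_neg_mul_sq_norm (V := E) (by norm_num : (0 : ℝ) < 1 / 2), hI]
    refine integral_congr_ae (Filter.Eventually.of_forall fun z => ?_)
    simp only
    ring_nf
  have hI0 : 0 < I := by
    rw [hIe]
    have := Real.pi_pos
    positivity
  have hi : Integrable fun z : E => Real.exp (-‖z‖ ^ 2 / 2) := by
    by_contra h
    rw [hI, integral_undef h] at hI0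
    exact lt_irrefl _ hI0
  refine ⟨I⁻¹, inv_pos.2 hI0, ?_⟩
  have : IsFiniteMeasure ((volume : Measure E).withDensity
      fun z => ENNReal.ofReal (I⁻¹ * Real.exp (-‖z‖ ^ 2 / 2))) :=
    isFiniteMeasure_withDensity_ofReal (hi.const_mul _).2
  refine Measure.ext_of_charFun ?_
  ext t
  rw [charFun_stdGaussian, charFun_apply, integral_withDensity_eq_integral_toReal_smul (by fun_prop)
    (Filter.Eventually.of_forall fun _ => ENNReal.ofReal_lt_top)]
  have h := GaussianFourier.integral_cexp_neg_mul_sq_norm_add (V := E) (b := 1 / 2) (by norm_num)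
    Complex.I t
  have hIc : ((Real.pi : ℂ) / (1 / 2)) ^ ((Module.finrank ℝ E : ℂ) / 2) = (I : ℂ) := by
    rw [hIe, Complex.ofReal_cpow (by have := Real.pi_pos; positivity)]
    push_cast
    rfl
  rw [hIc] at h
  have e : ∀ z : E, (ENNReal.ofReal (I⁻¹ * Real.exp (-‖z‖ ^ 2 / 2))).toReal •
      Complex.exp ((inner ℝ z t : ℝ) * Complex.I) =
      (I : ℂ)⁻¹ * Complex.exp (-(1 / 2) * (‖z‖ : ℂ) ^ 2 + Complex.I * (inner ℝ t z : ℝ)) := fun z => by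
    rw [ENNReal.toReal_ofReal (by positivity), Complex.real_smul, real_inner_comm z t]
    push_cast
    rw [mul_assoc, ← Complex.exp_add]
    congr 2
    ring
  simp only [e]
  rw [integral_const_mul, h, ← mul_assoc, inv_mul_cancel₀ (by exact_mod_cast hI0.ne'), one_mul]
  congr 1
  rw [Complex.I_sq]
  ring

/-- Expectations over the Gaussian channel `Y = X + Z`, written with the conditional density
of `Y` given `X`. -/
theorem lintegral_gaussianChannel {E : Type*} [NormedAddCommGroup E] [InnerProductSpace ℝ E]
    [FiniteDimensional ℝ E] [MeasurableSpace E] [BorelSpace E] {C : ℝ}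
    (hg : stdGaussian E =
      (volume : Measure E).withDensity fun z => ENNReal.ofReal (C * Real.exp (-‖z‖ ^ 2 / 2)))
    {Ω : Type*} [MeasurableSpace Ω] {P : Measure Ω} [IsProbabilityMeasure P]
    {X Z : Ω → E} (hX : Measurable X) (hZlaw : HasLaw Z (stdGaussian E) P) (hXZ : IndepFun X Z P)
    {F : E → E → ℝ≥0∞} (hF : Measurable (Function.uncurry F)) :
    ∫⁻ ω, F (X ω) (X ω + Z ω) ∂P = ∫⁻ y, ∫⁻ ω,
      ENNReal.ofReal (C * Real.exp (-‖X ω - y‖ ^ 2 / 2)) * F (X ω) y ∂P := by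
  have hlaw : HasLaw (fun ω => (X ω, Z ω)) ((P.map X).prod (stdGaussian E)) P :=
    IndepFun.hasLaw_prod ⟨hX.aemeasurable, rfl⟩ hZlaw hXZ
  have hPX : IsProbabilityMeasure (P.map X) := Measure.isProbabilityMeasure_map hX.aemeasurable
  have hG : Measurable fun q : E × E => F q.1 (q.1 + q.2) :=
    hF.comp (measurable_fst.prodMk (measurable_fst.add measurable_snd))
  have hw : Measurable fun q : E × E =>
      ENNReal.ofReal (C * Real.exp (-‖q.1 - q.2‖ ^ 2 / 2)) * F q.1 q.2 :=
    Measurable.mul (by fun_prop) hF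
  calc ∫⁻ ω, F (X ω) (X ω + Z ω) ∂P
      = ∫⁻ q, F q.1 (q.1 + q.2) ∂((P.map X).prod (stdGaussian E)) :=
        hlaw.lintegral_comp hG.aemeasurable
    _ = ∫⁻ x, ∫⁻ z, F x (x + z) ∂(stdGaussian E) ∂(P.map X) := lintegral_prod _ hG.aemeasurable
    _ = ∫⁻ x, (∫⁻ y, ENNReal.ofReal (C * Real.exp (-‖x - y‖ ^ 2 / 2)) * F x y) ∂(P.map X) := by
        refine lintegral_congr fun x => ?_
        have hGx : Measurable fun z => F x (x + z) := hG.comp measurable_prodMk_left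
        rw [hg, lintegral_withDensity_eq_lintegral_mul _ (by fun_prop) hGx]
        refine Eq.trans ?_ (lintegral_add_left_eq_self (μ := (volume : Measure E))
          (fun y => ENNReal.ofReal (C * Real.exp (-‖x - y‖ ^ 2 / 2)) * F x y) x)
        refine lintegral_congr fun z => ?_
        simp only [Pi.mul_apply, sub_add_cancel_left, norm_neg]
    _ = ∫⁻ y, ∫⁻ x, ENNReal.ofReal (C * Real.exp (-‖x - y‖ ^ 2 / 2)) * F x y ∂(P.map X) :=
        lintegral_lintegral_swap hw.aemeasurable
    _ = _ := by
        refine lintegral_congr fun y => ?_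
        have hwy : Measurable fun x => ENNReal.ofReal (C * Real.exp (-‖x - y‖ ^ 2 / 2)) * F x y :=
          Measurable.mul (by fun_prop) hF.of_uncurry_right
        exact lintegral_map hwy hX

end Density

/-! ### Reducing the Bayes risk to pointwise scalar problems -/

section Risk

variable {n : ℕ} {Ω : Type*} [MeasurableSpace Ω] {P : Measure Ω}
  {X Z : Ω → EuclideanSpace ℝ (Fin n)} {p : ℝ}

theorem lossFn_self (hp : p ≠ 0) (x : EuclideanSpace ℝ (Fin n)) :
    lossFn p p x = ∑ i, |x i| ^ p := by
  rw [lossFn, kNorm, ← Real.rpow_mul (Finset.sum_nonneg fun i _ => by positivity),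
    one_div_mul_cancel hp, Real.rpow_one]

/-- The Gaussian average `E[exp (-‖X - y‖² / 2)]`, proportional to the density of `X + Z`. -/
noncomputable def gaussAverage (P : Measure Ω) (X : Ω → EuclideanSpace ℝ (Fin n))
    (y : EuclideanSpace ℝ (Fin n)) : ℝ :=
  ∫ ω, Real.exp (-‖X ω - y‖ ^ 2 / 2) ∂P

/-- The `p`-th absolute deviation of the `i`-th coordinate of `X` from `c`, with
Gaussian weights centred at `y`. -/
noncomputable def gaussDeviation (P : Measure Ω) (X : Ω → EuclideanSpace ℝ (Fin n)) (p : ℝ)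
    (i : Fin n) (y : EuclideanSpace ℝ (Fin n)) (c : ℝ) : ℝ :=
  ∫ ω, Real.exp (-‖X ω - y‖ ^ 2 / 2) * |X ω i - c| ^ p ∂P

theorem gaussDeviation_nonneg (i : Fin n) (y : EuclideanSpace ℝ (Fin n)) (c : ℝ) :
    0 ≤ gaussDeviation P X p i y c :=
  integral_nonneg fun ω => by positivity

variable [IsProbabilityMeasure P]

/-- The Gaussian weight absorbs the growth of the loss, uniformly in `x`, so no moments of `X` are
needed. With `d = ‖x - y‖`, the term `2 d² exp(-d²/2)` contributes at most `4`, and the constant `1`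
makes `5`. -/
theorem exp_neg_sq_mul_abs_rpow_le (hp1 : 1 ≤ p) (hp2 : p ≤ 2) (i : Fin n)
    (x y : EuclideanSpace ℝ (Fin n)) {c M : ℝ} (hM : ‖y‖ + |c| ≤ M) :
    Real.exp (-‖x - y‖ ^ 2 / 2) * |x i - c| ^ p ≤ 5 + 2 * M ^ 2 := by
  have h1 : |x i - c| ≤ ‖x - y‖ + M := by
    have a : |x i - y i| ≤ ‖x - y‖ := by
      simpa using PiLp.norm_apply_le (x - y) i
    have b : |y i| ≤ ‖y‖ := by simpa using PiLp.norm_apply_le y i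
    calc |x i - c| = |(x i - y i) + (y i - c)| := by ring_nf
      _ ≤ |x i - y i| + |y i - c| := abs_add_le _ _
      _ ≤ |x i - y i| + (|y i| + |c|) := by gcongr; exact abs_sub _ _
      _ ≤ _ := by linarith
  have hM0 : 0 ≤ M := (by positivity : 0 ≤ ‖y‖ + |c|).trans hM
  have h2 : |x i - c| ^ p ≤ 1 + 2 * M ^ 2 + 2 * ‖x - y‖ ^ 2 := by
    have a := rpow_le_one_add_sq (by linarith) hp2 (abs_nonneg (x i - c))
    nlinarith [abs_nonneg (x i - c), norm_nonneg (x - y), sq_nonneg (‖x - y‖ - M)]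
  set d := ‖x - y‖
  have h3 : Real.exp (-d ^ 2 / 2) ≤ 1 := Real.exp_le_one_iff.2 (by nlinarith [sq_nonneg d])
  have h4 : Real.exp (-d ^ 2 / 2) * (d ^ 2 / 2) ≤ 1 := by
    have a := Real.add_one_le_exp (d ^ 2 / 2)
    have b : Real.exp (-d ^ 2 / 2) * Real.exp (d ^ 2 / 2) = 1 := by
      rw [← Real.exp_add]; ring_nf; exact Real.exp_zero
    nlinarith [Real.exp_pos (-d ^ 2 / 2)]
  have h5 := Real.exp_pos (-d ^ 2 / 2)
  calc _ ≤ Real.exp (-d ^ 2 / 2) * (1 + 2 * M ^ 2 + 2 * d ^ 2) := by gcongr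
    _ ≤ _ := by nlinarith [mul_nonneg (sub_nonneg.2 h3) (by positivity : 0 ≤ 1 + 2 * M ^ 2)]

theorem integrable_gaussDeviation (hX : Measurable X) (hp1 : 1 ≤ p) (hp2 : p ≤ 2) (i : Fin n)
    (y : EuclideanSpace ℝ (Fin n)) (c : ℝ) :
    Integrable (fun ω => Real.exp (-‖X ω - y‖ ^ 2 / 2) * |X ω i - c| ^ p) P := by
  refine (integrable_const (5 + 2 * (‖y‖ + |c|) ^ 2)).mono' (by fun_prop)
    (Filter.Eventually.of_forall fun ω => ?_)
  rw [Real.norm_of_nonneg (by positivity)]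
  exact exp_neg_sq_mul_abs_rpow_le hp1 hp2 i _ y le_rfl

theorem continuous_gaussDeviation (hX : Measurable X) (hp1 : 1 ≤ p) (hp2 : p ≤ 2) (i : Fin n) :
    Continuous fun q : EuclideanSpace ℝ (Fin n) × ℝ => gaussDeviation P X p i q.1 q.2 := by
  rw [continuous_iff_continuousAt]
  intro q₀
  simp only [gaussDeviation]
  have hev : ∀ᶠ q in nhds q₀, ‖q.1‖ + |q.2| < ‖q₀.1‖ + |q₀.2| + 1 := by
    have : Continuous fun q : EuclideanSpace ℝ (Fin n) × ℝ => ‖q.1‖ + |q.2| := by fun_prop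
    exact this.continuousAt.eventually_lt continuousAt_const (by linarith)
  refine continuousAt_of_dominated (bound := fun _ => 5 + 2 * (‖q₀.1‖ + |q₀.2| + 1) ^ 2)
    (Filter.Eventually.of_forall fun q =>
      (integrable_gaussDeviation hX hp1 hp2 i q.1 q.2).aestronglyMeasurable)
    ?_ (integrable_const _) (Filter.Eventually.of_forall fun ω => ?_)
  · filter_upwards [hev] with q hq
    refine Filter.Eventually.of_forall fun ω => ?_
    rw [Real.norm_of_nonneg (by positivity)]
    exact exp_neg_sq_mul_abs_rpow_le hp1 hp2 i _ _ hq.le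
  · have : Continuous fun q : EuclideanSpace ℝ (Fin n) × ℝ => |X ω i - q.2| ^ p :=
      (by fun_prop : Continuous fun q : EuclideanSpace ℝ (Fin n) × ℝ => |X ω i - q.2|).rpow_const
        fun _ => Or.inr (by linarith)
    have h2 : Continuous fun q : EuclideanSpace ℝ (Fin n) × ℝ =>
      Real.exp (-‖X ω - q.1‖ ^ 2 / 2) := by fun_prop
    exact (h2.mul this).continuousAt

theorem continuous_gaussDeviation_comp (hX : Measurable X) (hp1 : 1 ≤ p) (hp2 : p ≤ 2) (i : Fin n)
    {g : EuclideanSpace ℝ (Fin n) → ℝ} (hg : Continuous g) :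
    Continuous fun y => gaussDeviation P X p i y (g y) := by
  have h := continuous_gaussDeviation (P := P) hX hp1 hp2 i
  have hg' : Continuous fun y => (y, g y) := continuous_id.prodMk hg
  have h' := h.comp hg'
  simp only [Function.comp_def] at h'
  exact h'

theorem bayesRisk_eq_lintegral (hX : Measurable X)
    (hZlaw : HasLaw Z (stdGaussian (EuclideanSpace ℝ (Fin n))) P) (hXZ : IndepFun X Z P)
    (hp1 : 1 ≤ p) (hp2 : p ≤ 2) :
    ∃ C : ℝ, 0 < C ∧ ∀ g : EuclideanSpace ℝ (Fin n) → EuclideanSpace ℝ (Fin n), Measurable g →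
      _root_.bayesRisk P X (fun ω => X ω + Z ω) p p g =
        ∫⁻ y, ENNReal.ofReal (C * ∑ i, gaussDeviation P X p i y (g y i)) := by
  obtain ⟨C, hC, h⟩ := exists_stdGaussian_eq_withDensity (EuclideanSpace ℝ (Fin n))
  refine ⟨C, hC, fun g hg => ?_⟩
  have hp0 : p ≠ 0 := by linarith
  rw [_root_.bayesRisk, lintegral_gaussianChannel h hX hZlaw hXZ
    (F := fun x y => ENNReal.ofReal (lossFn p p (x - g y))) (by
    simp only [lossFn_self hp0, Function.uncurry_def]
    fun_prop)]
  refine lintegral_congr fun y => ?_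
  have e : ∀ ω, ENNReal.ofReal (C * Real.exp (-‖X ω - y‖ ^ 2 / 2)) *
      ENNReal.ofReal (lossFn p p (X ω - g y)) =
      ENNReal.ofReal (∑ i, C * (Real.exp (-‖X ω - y‖ ^ 2 / 2) * |X ω i - g y i| ^ p)) := fun ω => by
    rw [← ENNReal.ofReal_mul (by positivity), lossFn_self hp0, Finset.mul_sum]
    simp only [PiLp.sub_apply, mul_assoc]
  simp only [e]
  rw [← ofReal_integral_eq_lintegral_ofReal
    (integrable_finsetSum _ fun i _ => (integrable_gaussDeviation hX hp1 hp2 i y _).const_mul C)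
    (Filter.Eventually.of_forall fun ω => Finset.sum_nonneg fun i _ => by positivity),
    integral_finsetSum _ fun i _ => (integrable_gaussDeviation hX hp1 hp2 i y _).const_mul C,
    Finset.mul_sum]
  simp only [integral_const_mul, gaussDeviation]

/-- The estimator `y` has error `-Z`, so the optimal risk is finite for every law of `X`; strict
comparisons of risks rely on this. -/
theorem bayesRisk_id_lt_top (hZ : Measurable Z)
    (hZlaw : HasLaw Z (stdGaussian (EuclideanSpace ℝ (Fin n))) P) (hp1 : 1 ≤ p) (hp2 : p ≤ 2) :
    _root_.bayesRisk P X (fun ω => X ω + Z ω) p p id < ∞ := by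
  have hp0 : p ≠ 0 := by linarith
  have h2 : Integrable (fun ω => ‖Z ω‖ ^ 2) P := by
    have : MemLp id 2 (stdGaussian (EuclideanSpace ℝ (Fin n))) := IsGaussian.memLp_two_id
    rw [← hZlaw.map_eq] at this
    exact (memLp_two_iff_integrable_sq_norm hZ.aestronglyMeasurable).1
      (this.comp_of_map hZ.aemeasurable)
  have hi : Integrable (fun ω => ∑ i : Fin n, (1 + ‖Z ω‖ ^ 2)) P :=
    integrable_finsetSum _ fun i _ => (integrable_const 1).add h2
  refine lt_of_le_of_lt (lintegral_mono fun ω => ENNReal.ofReal_le_ofReal ?_) hi.lintegral_lt_top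
  rw [lossFn_self hp0]
  refine Finset.sum_le_sum fun i _ => ?_
  have hz : |(X ω - id (X ω + Z ω)) i| ≤ ‖Z ω‖ := by
    simpa using PiLp.norm_apply_le (Z ω) i
  refine (rpow_le_one_add_sq (by linarith) hp2 (abs_nonneg _)).trans ?_
  gcongr

/-- An optimal continuous estimator minimises every weighted coordinate deviation pointwise. -/
theorem gaussDeviation_le_of_isOptimalEstimator (hX : Measurable X) (hZ : Measurable Z)
    (hZlaw : HasLaw Z (stdGaussian (EuclideanSpace ℝ (Fin n))) P) (hXZ : IndepFun X Z P)
    (hp1 : 1 ≤ p) (hp2 : p ≤ 2) {f : EuclideanSpace ℝ (Fin n) → EuclideanSpace ℝ (Fin n)}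
    (hf : Continuous f) (hopt : IsOptimalEstimator P X (fun ω => X ω + Z ω) p p f) (i : Fin n)
    (y : EuclideanSpace ℝ (Fin n)) (c : ℝ) :
    gaussDeviation P X p i y (f y i) ≤ gaussDeviation P X p i y c := by
  obtain ⟨C, hC, hrisk⟩ := bayesRisk_eq_lintegral hX hZlaw hXZ hp1 hp2
  by_contra! hlt
  have hc1 : Continuous fun y => gaussDeviation P X p i y c :=
    continuous_gaussDeviation_comp hX hp1 hp2 i continuous_const
  have hcf : ∀ j, Continuous fun y => gaussDeviation P X p j y (f y j) := fun j =>
    continuous_gaussDeviation_comp hX hp1 hp2 j ((PiLp.continuous_apply 2 _ j).comp hf)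
  -- By continuity a strict improvement at one point persists on an open set, which has positive
  -- volume. Replacing coordinate `i` by `c` there strictly lowers the risk.
  obtain ⟨U, hUo, hUmem⟩ : ∃ U : Set (EuclideanSpace ℝ (Fin n)), IsOpen U ∧ ∀ y, y ∈ U ↔
      gaussDeviation P X p i y c < gaussDeviation P X p i y (f y i) :=
    ⟨_, isOpen_lt hc1 (hcf i), fun y => Iff.rfl⟩
  have hUpos : volume U ≠ 0 := (hUo.measure_pos volume ⟨y, (hUmem y).2 hlt⟩).ne'
  obtain ⟨g, hgm, hgU, hgN⟩ : ∃ g : EuclideanSpace ℝ (Fin n) → EuclideanSpace ℝ (Fin n),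
      Measurable g ∧ (∀ y ∈ U, g y = WithLp.toLp 2 (Function.update (f y).ofLp i c)) ∧
      ∀ y ∉ U, g y = f y := by
    classical
    refine ⟨fun y => if y ∈ U then WithLp.toLp 2 (Function.update (f y).ofLp i c) else f y, ?_,
      fun y hy => if_pos hy, fun y hy => if_neg hy⟩
    refine Measurable.ite hUo.measurableSet ?_ hf.measurable
    have : Continuous fun y => WithLp.toLp 2 (Function.update (f y).ofLp i c) :=
      (PiLp.continuous_toLp 2 _).comp
        (((PiLp.continuous_ofLp 2 _).comp hf).update i continuous_const)
    exact this.measurable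
  have hgi : ∀ y ∈ U, ∀ j, gaussDeviation P X p j y (g y j) ≤ gaussDeviation P X p j y (f y j) ∧
      (j = i → gaussDeviation P X p j y (g y j) < gaussDeviation P X p j y (f y j)) :=
    fun y hy j => by
      simp only [hgU y hy]
      rcases eq_or_ne j i with rfl | hj
      · rw [Function.update_self]
        exact ⟨((hUmem y).1 hy).le, fun _ => (hUmem y).1 hy⟩
      · rw [Function.update_of_ne hj]
        exact ⟨le_rfl, fun h => absurd h hj⟩
  have hgle : ∀ y j, gaussDeviation P X p j y (g y j) ≤ gaussDeviation P X p j y (f y j) :=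
    fun y j => by
      by_cases hy : y ∈ U
      · exact (hgi y hy j).1
      · rw [hgN y hy]
  have hmono : ∀ y, ENNReal.ofReal (C * ∑ j, gaussDeviation P X p j y (g y j)) ≤
      ENNReal.ofReal (C * ∑ j, gaussDeviation P X p j y (f y j)) := fun y =>
    ENNReal.ofReal_le_ofReal (mul_le_mul_of_nonneg_left (Finset.sum_le_sum fun j _ => hgle y j) hC.le)
  have hle := hopt.2 g hgm
  have hfin : _root_.bayesRisk P X (fun ω => X ω + Z ω) p p g ≠ ∞ := by
    have hlt : _root_.bayesRisk P X (fun ω => X ω + Z ω) p p g ≤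
        _root_.bayesRisk P X (fun ω => X ω + Z ω) p p f := by
      rw [hrisk g hgm, hrisk f hf.measurable]
      exact lintegral_mono hmono
    exact (hlt.trans_lt ((hopt.2 id measurable_id).trans_lt
      (bayesRisk_id_lt_top hZ hZlaw hp1 hp2))).ne
  rw [hrisk g hgm] at hfin
  rw [hrisk g hgm, hrisk f hf.measurable] at hle
  refine absurd hle (not_le.2 ?_)
  refine lintegral_strict_mono_of_ae_le_of_ae_lt_on ?_ hfin (Filter.Eventually.of_forall hmono) hUpos
    (Filter.Eventually.of_forall fun y hy => ?_)
  · exact (ENNReal.continuous_ofReal.comp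
      (continuous_const.mul (continuous_finsetSum _ fun j _ => hcf j))).measurable.aemeasurable
  · have hs : ∑ j, gaussDeviation P X p j y (g y j) < ∑ j, gaussDeviation P X p j y (f y j) :=
      Finset.sum_lt_sum (fun j _ => (hgi y hy j).1) ⟨i, Finset.mem_univ i, (hgi y hy i).2 rfl⟩
    refine (ENNReal.ofReal_lt_ofReal_iff_of_nonneg ?_).2 (mul_lt_mul_of_pos_left hs hC)
    exact mul_nonneg hC.le (Finset.sum_nonneg fun j _ => gaussDeviation_nonneg _ _ _)

end Risk

/-! ### Exponential tilting and the density of the observation -/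

section Shift

variable {n : ℕ}

theorem norm_sub_add_single_sq (x y : EuclideanSpace ℝ (Fin n)) (i : Fin n) (s : ℝ) :
    ‖x - (y + EuclideanSpace.single i s)‖ ^ 2 = ‖x - y‖ ^ 2 - 2 * (s * (x i - y i)) + s ^ 2 := by
  rw [← sub_sub, norm_sub_sq_real, EuclideanSpace.inner_single_right]
  simp

theorem exp_neg_norm_sub_add_single_sq (x y : EuclideanSpace ℝ (Fin n)) (i : Fin n) (s : ℝ) :
    Real.exp (-‖x - (y + EuclideanSpace.single i s)‖ ^ 2 / 2) =
      Real.exp (-(s * y i) - s ^ 2 / 2) *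
        (Real.exp (-‖x - y‖ ^ 2 / 2) * Real.exp (s * x i)) := by
  rw [norm_sub_add_single_sq, ← Real.exp_add, ← Real.exp_add]
  ring_nf

theorem dotProduct_mulVec_add_single {A : Matrix (Fin n) (Fin n) ℝ} (hA : A.IsSymm)
    (y : Fin n → ℝ) (i : Fin n) (s : ℝ) :
    (y + Pi.single i s) ⬝ᵥ (A *ᵥ (y + Pi.single i s)) =
      y ⬝ᵥ (A *ᵥ y) + 2 * s * (A *ᵥ y) i + s ^ 2 * A i i := by
  have h1 : (Pi.single i s : Fin n → ℝ) ⬝ᵥ (A *ᵥ y) = s * (A *ᵥ y) i := single_dotProduct _ _ _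
  have h2 : y ⬝ᵥ (A *ᵥ Pi.single i s) = s * (A *ᵥ y) i := by
    rw [Matrix.dotProduct_mulVec, ← Matrix.mulVec_transpose, hA.eq, dotProduct_comm, h1]
  have h3 : (Pi.single i s : Fin n → ℝ) ⬝ᵥ (A *ᵥ Pi.single i s) = s ^ 2 * A i i := by
    rw [single_dotProduct, Matrix.mulVec_single]
    simp
    ring
  rw [Matrix.mulVec_add, add_dotProduct, dotProduct_add, dotProduct_add, h1, h2, h3]
  ring

variable {Ω : Type*} [MeasurableSpace Ω] {P : Measure Ω} [IsProbabilityMeasure P]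
  {X : Ω → EuclideanSpace ℝ (Fin n)} {p : ℝ}

theorem integrable_gaussAverage (hX : Measurable X) (y : EuclideanSpace ℝ (Fin n)) :
    Integrable (fun ω => Real.exp (-‖X ω - y‖ ^ 2 / 2)) P := by
  refine (integrable_const 1).mono' (by fun_prop) (Filter.Eventually.of_forall fun ω => ?_)
  rw [Real.norm_of_nonneg (Real.exp_pos _).le, Real.exp_le_one_iff]
  nlinarith [sq_nonneg ‖X ω - y‖]

theorem gaussAverage_pos (hX : Measurable X) (y : EuclideanSpace ℝ (Fin n)) :
    0 < gaussAverage P X y :=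
  integral_exp_pos (integrable_gaussAverage hX y)

/-- Under the measure weighted by `exp(-‖X - y‖²/2)`, a shift of `y` along `e_i` is an exponential
tilt in `X i`, and the claimed minimiser is `A i i * s + (A y)_i`. The scalar theorem then gives the
Laplace transform of `X i`. -/
theorem gaussAverage_add_single (hX : Measurable X) (hp1 : 1 ≤ p) (hp2 : p ≤ 2)
    {A : Matrix (Fin n) (Fin n) ℝ} (hA : A.PosDef) (i : Fin n)
    (h : ∀ y c, gaussDeviation P X p i y ((A *ᵥ y.ofLp) i) ≤ gaussDeviation P X p i y c)
    (y : EuclideanSpace ℝ (Fin n)) (s : ℝ) :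
    gaussAverage P X (y + EuclideanSpace.single i s) =
      gaussAverage P X y * Real.exp (s * (A *ᵥ y.ofLp) i + s ^ 2 * A i i / 2 - s * y i - s ^ 2 / 2) := by
  set P' : Measure Ω := P.withDensity fun ω => ENNReal.ofReal (Real.exp (-‖X ω - y‖ ^ 2 / 2)) with hP'
  have hint : ∀ f : Ω → ℝ, ∫ ω, f ω ∂P' = ∫ ω, Real.exp (-‖X ω - y‖ ^ 2 / 2) * f ω ∂P := fun f => by
    rw [hP', integral_withDensity_eq_integral_toReal_smul (by fun_prop)
      (Filter.Eventually.of_forall fun _ => ENNReal.ofReal_lt_top)]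
    simp only [ENNReal.toReal_ofReal (Real.exp_pos _).le, smul_eq_mul]
  have hdev : ∀ s c, gaussDeviation P X p i (y + EuclideanSpace.single i s) c =
      Real.exp (-(s * y i) - s ^ 2 / 2) * ∫ ω, |X ω i - c| ^ p * Real.exp (s * X ω i) ∂P' :=
    fun s c => by
      rw [hint, gaussDeviation, ← integral_const_mul]
      refine integral_congr_ae (Filter.Eventually.of_forall fun ω => ?_)
      simp only [exp_neg_norm_sub_add_single_sq]
      ring
  have hav : ∀ s, gaussAverage P X (y + EuclideanSpace.single i s) =
      Real.exp (-(s * y i) - s ^ 2 / 2) * ∫ ω, Real.exp (s * X ω i) ∂P' := fun s => by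
    rw [hint, gaussAverage, ← integral_const_mul]
    refine integral_congr_ae (Filter.Eventually.of_forall fun ω => ?_)
    simp only [exp_neg_norm_sub_add_single_sq]
  have huniv : P'.real Set.univ = gaussAverage P X y := by
    have := hint fun _ => 1
    simpa [gaussAverage] using this
  have hexp : ∀ s, Integrable (fun ω => Real.exp (s * X ω i)) P' := fun s => by
    rw [hP', integrable_withDensity_iff_integrable_smul' (by fun_prop)
      (Filter.Eventually.of_forall fun _ => ENNReal.ofReal_lt_top)]
    refine ((integrable_gaussAverage (P := P) hX (y + EuclideanSpace.single i s)).const_mul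
      (Real.exp (-(s * y i) - s ^ 2 / 2))⁻¹).congr (Filter.Eventually.of_forall fun ω => ?_)
    simp only [exp_neg_norm_sub_add_single_sq, ENNReal.toReal_ofReal (Real.exp_pos _).le, smul_eq_mul]
    rw [inv_mul_cancel_left₀ (Real.exp_ne_zero _)]
  have hXi : Measurable fun ω => X ω i := by fun_prop
  have main := integral_exp_of_minimizer_affine hXi hp1 hp2 (a := A i i) (b := (A *ᵥ y.ofLp) i)
    hA.diag_pos hexp (fun s c => by
      have h1 := h (y + EuclideanSpace.single i s) c
      have h2 : (A *ᵥ (y + EuclideanSpace.single i s).ofLp) i = A i i * s + (A *ᵥ y.ofLp) i := by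
        rw [WithLp.ofLp_add, Matrix.mulVec_add, Pi.add_apply, add_comm]
        simp [Matrix.mulVec_single, mul_comm]
      rw [h2, hdev, hdev] at h1
      exact le_of_mul_le_mul_left h1 (Real.exp_pos _)) s
  rw [hav, main, huniv, mul_comm (gaussAverage P X y), ← mul_assoc, ← Real.exp_add]
  ring_nf

/-- If `A y` minimises all weighted coordinate deviations, then the density of `X + Z` is an
explicit Gaussian. -/
theorem gaussAverage_eq_of_minimizer (hX : Measurable X) (hp1 : 1 ≤ p) (hp2 : p ≤ 2)
    {A : Matrix (Fin n) (Fin n) ℝ} (hA : A.PosDef)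
    (h : ∀ i y c, gaussDeviation P X p i y ((A *ᵥ y.ofLp) i) ≤ gaussDeviation P X p i y c)
    (y : EuclideanSpace ℝ (Fin n)) :
    gaussAverage P X y =
      gaussAverage P X 0 * Real.exp ((y.ofLp ⬝ᵥ (A *ᵥ y.ofLp)) / 2 - ‖y‖ ^ 2 / 2) := by
  have hsymm : A.IsSymm := by simpa using hA.isHermitian
  -- Induction on a set containing the support of `y`: each coordinate is restored by one shift, and
  -- the exponents add up to the quadratic form.
  have key : ∀ S : Finset (Fin n), ∀ y : EuclideanSpace ℝ (Fin n), (∀ i ∉ S, y i = 0) →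
      gaussAverage P X y =
      gaussAverage P X 0 * Real.exp ((y.ofLp ⬝ᵥ (A *ᵥ y.ofLp)) / 2 - ‖y‖ ^ 2 / 2) := by
    intro S
    induction S using Finset.induction_on with
    | empty =>
      intro y hy
      have : y = 0 := by ext i; simpa using hy i
      simp [this]
    | insert i S hi ih =>
      intro y hy
      set z : EuclideanSpace ℝ (Fin n) := y - EuclideanSpace.single i (y i) with hz
      have hyz : y = z + EuclideanSpace.single i (y i) := by simp [hz]
      have hz0 : ∀ j ∉ S, z j = 0 := fun j hj => by
        rcases eq_or_ne j i with rfl | hji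
        · simp [hz]
        · simp [hz, hji, hy j (by simp [hj, hji])]
      have h1 := ih z hz0
      have h2 := gaussAverage_add_single hX hp1 hp2 hA i (h i) z (y i)
      have h3 := dotProduct_mulVec_add_single hsymm z.ofLp i (y i)
      have h4 := norm_sub_add_single_sq 0 z i (y i)
      rw [zero_sub, zero_sub, norm_neg, norm_neg, ← hyz] at h4
      have h5 : z.ofLp + Pi.single i (y i) = y.ofLp := by
        conv_rhs => rw [hyz]
        simp
      rw [h5] at h3
      rw [← hyz, h1, mul_assoc, ← Real.exp_add] at h2
      rw [h2, h3, h4]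
      congr 2
      simp
      ring
  exact key Finset.univ y fun i hi => absurd (Finset.mem_univ i) hi

/-- The Gaussian averages of a probability measure vanish at infinity along lines. -/
theorem tendsto_gaussAverage_smul (hX : Measurable X) {v : EuclideanSpace ℝ (Fin n)} (hv : v ≠ 0) :
    Filter.Tendsto (fun s : ℝ => gaussAverage P X (s • v)) Filter.atTop (nhds 0) := by
  have h0 : (0 : ℝ) = ∫ _ : Ω, (0 : ℝ) ∂P := by simp
  rw [h0]
  refine tendsto_integral_filter_of_dominated_convergence (fun _ => 1)
    (Filter.Eventually.of_forall fun s => (integrable_gaussAverage hX _).aestronglyMeasurable)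
    (Filter.Eventually.of_forall fun s => Filter.Eventually.of_forall fun ω => ?_)
    (integrable_const 1) (Filter.Eventually.of_forall fun ω => ?_)
  · rw [Real.norm_of_nonneg (Real.exp_pos _).le, Real.exp_le_one_iff]
    nlinarith [sq_nonneg ‖X ω - s • v‖]
  · refine Real.tendsto_exp_atBot.comp ?_
    have hn : Filter.Tendsto (fun s : ℝ => ‖X ω - s • v‖) Filter.atTop Filter.atTop := by
      refine Filter.tendsto_atTop_mono (f := fun s : ℝ => s * ‖v‖ - ‖X ω‖) (fun s => ?_) ?_
      · have a := norm_sub_norm_le (s • v) (X ω)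
        rw [norm_sub_rev, norm_smul, Real.norm_eq_abs] at a
        have b := mul_le_mul_of_nonneg_right (le_abs_self s) (norm_nonneg v)
        linarith
      · exact Filter.tendsto_atTop_add_const_right _ _
          (Filter.tendsto_id.atTop_mul_const (norm_pos_iff.2 hv))
    have h2 := ((Filter.tendsto_pow_atTop two_ne_zero).comp hn).const_mul_atTop_of_neg
      (by norm_num : (-1 / 2 : ℝ) < 0)
    refine h2.congr fun s => ?_
    simp only [Function.comp_apply]
    ring

theorem continuous_linearEstimator (A : Matrix (Fin n) (Fin n) ℝ) :
    Continuous (linearEstimator A) := by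
  unfold linearEstimator
  fun_prop

theorem not_isOptimalEstimator_of_eigenvalue {Z : Ω → EuclideanSpace ℝ (Fin n)}
    (hX : Measurable X) (hZ : Measurable Z)
    (hZlaw : HasLaw Z (stdGaussian (EuclideanSpace ℝ (Fin n))) P) (hXZ : IndepFun X Z P)
    (hp1 : 1 ≤ p) (hp2 : p ≤ 2) {A : Matrix (Fin n) (Fin n) ℝ} (hA : A.PosDef) {l : ℝ} (hl : 1 ≤ l)
    (hlA : Module.End.HasEigenvalue (Matrix.toLin' A) l) :
    ¬ IsOptimalEstimator P X (fun ω => X ω + Z ω) p p (linearEstimator A) := by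
  intro hopt
  have h := gaussAverage_eq_of_minimizer hX hp1 hp2 hA fun i y c =>
    gaussDeviation_le_of_isOptimalEstimator hX hZ hZlaw hXZ hp1 hp2 (continuous_linearEstimator A)
      hopt i y c
  obtain ⟨w, hw⟩ := hlA.exists_hasEigenvector
  have hAw : A *ᵥ w = l • w := by simpa using hw.apply_eq_smul
  set v : EuclideanSpace ℝ (Fin n) := WithLp.toLp 2 w with hv
  have hv0 : v ≠ 0 := by simpa [hv] using hw.2
  -- Along an eigenvector the exponent is `(l - 1) ‖s v‖² / 2 ≥ 0`, so the average cannot fall below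
  -- its value at `0`, whereas it must tend to `0`.
  have hge : ∀ s : ℝ, gaussAverage P X 0 ≤ gaussAverage P X (s • v) := fun s => by
    rw [h (s • v)]
    refine le_mul_of_one_le_right (gaussAverage_pos hX 0).le (Real.one_le_exp ?_)
    have h1 : (s • v).ofLp ⬝ᵥ (A *ᵥ (s • v).ofLp) = l * ‖s • v‖ ^ 2 := by
      rw [EuclideanSpace.real_norm_sq_eq]
      simp only [hv, WithLp.ofLp_smul, Matrix.mulVec_smul, hAw, dotProduct, Pi.smul_apply,
        smul_eq_mul, Finset.mul_sum, PiLp.smul_apply]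
      exact Finset.sum_congr rfl fun i _ => by ring
    rw [h1]
    nlinarith [sq_nonneg ‖s • v‖]
  have := ge_of_tendsto' (tendsto_gaussAverage_smul (P := P) hX hv0) hge
  exact absurd (gaussAverage_pos (P := P) hX 0) (not_lt.2 this)

end Shift

/-! ### The Gaussian prior: error and observation are independent -/

section GaussianPrior

variable {n : ℕ}

theorem real_inner_eq_dotProduct (x y : EuclideanSpace ℝ (Fin n)) :
    inner ℝ x y = x.ofLp ⬝ᵥ y.ofLp := by
  rw [EuclideanSpace.inner_eq_star_dotProduct, star_trivial, dotProduct_comm]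

/-- The right side is a congruence of `(1 - A)⁻¹` plus `A`, which makes positivity of the prior
covariance visible. -/
theorem inv_one_sub_mul_eq {A : Matrix (Fin n) (Fin n) ℝ} (hB : (1 - A).PosDef) :
    (1 - A)⁻¹ * A = A * (1 - A)⁻¹ * A + A := by
  have hu : IsUnit (1 - A).det := (Matrix.isUnit_iff_isUnit_det _).1 hB.isUnit
  have h2 : (1 - A) * (1 - A)⁻¹ = 1 := Matrix.mul_nonsing_inv _ hu
  rw [sub_mul, one_mul, sub_eq_iff_eq_add] at h2
  nth_rewrite 1 [h2]
  rw [add_mul, one_mul, add_comm]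

theorem posSemidef_inv_one_sub_mul {A : Matrix (Fin n) (Fin n) ℝ} (hA : A.PosDef)
    (hB : (1 - A).PosDef) : ((1 - A)⁻¹ * A).PosSemidef := by
  have h := hB.inv.posSemidef.mul_mul_conjTranspose_same A
  rw [hA.isHermitian.eq] at h
  rw [inv_one_sub_mul_eq hB]
  exact h.add hA.posSemidef

theorem inv_one_sub_mul_mul_one_sub {A : Matrix (Fin n) (Fin n) ℝ} (hB : (1 - A).PosDef) :
    (1 - A)⁻¹ * A * (1 - A) = A := by
  have hu : IsUnit (1 - A).det := (Matrix.isUnit_iff_isUnit_det _).1 hB.isUnit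
  have hc : A * (1 - A) = (1 - A) * A := by rw [mul_sub, sub_mul, mul_one, one_mul]
  rw [mul_assoc, hc, ← mul_assoc, Matrix.nonsing_inv_mul _ hu, one_mul]

/-- With `S = (1 - A)⁻¹ A`, the left side is the variance of `⟨X - A Y, a⟩ + ⟨Y, b⟩`, written
through `X` and `Z`. The right side has no cross term in `a` and `b`, whence independence, with
error covariance `A`. -/
theorem quadratic_form_identity {A : Matrix (Fin n) (Fin n) ℝ} (hA : A.PosDef)
    (hB : (1 - A).PosDef) (a b : Fin n → ℝ) :
    ((a - A *ᵥ a) + b) ⬝ᵥ (((1 - A)⁻¹ * A) *ᵥ ((a - A *ᵥ a) + b)) +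
      (b - A *ᵥ a) ⬝ᵥ (b - A *ᵥ a) =
    a ⬝ᵥ (A *ᵥ a) + (b ⬝ᵥ (((1 - A)⁻¹ * A) *ᵥ b) + b ⬝ᵥ b) := by
  set S := (1 - A)⁻¹ * A with hS
  have hSs : Sᵀ = S := by
    rw [← Matrix.conjTranspose_eq_transpose_of_trivial]
    exact (posSemidef_inv_one_sub_mul hA hB).isHermitian.eq
  have h1 : S *ᵥ (a - A *ᵥ a) = A *ᵥ a := by
    have : a - A *ᵥ a = (1 - A) *ᵥ a := by rw [Matrix.sub_mulVec, Matrix.one_mulVec]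
    rw [this, Matrix.mulVec_mulVec, hS, inv_one_sub_mul_mul_one_sub hB]
  have h2 : (a - A *ᵥ a) ⬝ᵥ (S *ᵥ b) = b ⬝ᵥ (A *ᵥ a) := by
    rw [Matrix.dotProduct_mulVec, ← Matrix.mulVec_transpose, hSs, h1, dotProduct_comm]
  rw [Matrix.mulVec_add, add_dotProduct, dotProduct_add, dotProduct_add, h1, h2]
  simp only [sub_dotProduct, dotProduct_sub, dotProduct_comm (A *ᵥ a) b]
  ring

variable {Ω : Type*} [MeasurableSpace Ω] {P : Measure Ω} [IsProbabilityMeasure P]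
  {X Z : Ω → EuclideanSpace ℝ (Fin n)} {A : Matrix (Fin n) (Fin n) ℝ}

theorem integral_cexp_inner_add_inner {S : Matrix (Fin n) (Fin n) ℝ} (hS : S.PosSemidef)
    (hX : Measurable X) (hZ : Measurable Z)
    (hXlaw : HasLaw X (multivariateGaussian 0 S) P)
    (hZlaw : HasLaw Z (stdGaussian (EuclideanSpace ℝ (Fin n))) P) (hXZ : IndepFun X Z P)
    (c d : EuclideanSpace ℝ (Fin n)) :
    ∫ ω, Complex.exp ((inner ℝ (X ω) c + inner ℝ (Z ω) d : ℝ) * Complex.I) ∂P =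
      Complex.exp ((-(c.ofLp ⬝ᵥ (S *ᵥ c.ofLp) + d.ofLp ⬝ᵥ d.ofLp) / 2 : ℝ)) := by
  have h := (indepFun_iff_charFun_prod hX.aemeasurable hZ.aemeasurable).1 hXZ (WithLp.toLp 2 (c, d))
  rw [hXlaw.map_eq, hZlaw.map_eq, charFun_multivariateGaussian hS, charFun_stdGaussian,
    charFun_apply, integral_map (by fun_prop) (by fun_prop)] at h
  simp only [WithLp.prod_inner_apply] at h
  rw [h, ← Complex.exp_add, inner_zero_right, ← real_inner_eq_dotProduct d d,
    real_inner_self_eq_norm_sq]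
  congr 1
  push_cast
  ring

theorem linearEstimator_eq_toLp (A : Matrix (Fin n) (Fin n) ℝ) (y : EuclideanSpace ℝ (Fin n)) :
    (linearEstimator A y).ofLp = A *ᵥ y.ofLp := rfl

/-- The joint characteristic function of the error `X - A Y` and the observation `Y = X + Z`
for the Gaussian prior. -/
theorem integral_cexp_error_observation (hA : A.PosDef) (hB : (1 - A).PosDef)
    (hX : Measurable X) (hZ : Measurable Z)
    (hXlaw : HasLaw X (multivariateGaussian 0 ((1 - A)⁻¹ * A)) P)
    (hZlaw : HasLaw Z (stdGaussian (EuclideanSpace ℝ (Fin n))) P) (hXZ : IndepFun X Z P)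
    (a b : EuclideanSpace ℝ (Fin n)) :
    ∫ ω, Complex.exp ((inner ℝ (X ω - linearEstimator A (X ω + Z ω)) a +
        inner ℝ (X ω + Z ω) b : ℝ) * Complex.I) ∂P =
      Complex.exp ((-(a.ofLp ⬝ᵥ (A *ᵥ a.ofLp) +
        (b.ofLp ⬝ᵥ (((1 - A)⁻¹ * A) *ᵥ b.ofLp) + b.ofLp ⬝ᵥ b.ofLp)) / 2 : ℝ)) := by
  have hAt : Aᵀ = A := by simpa using hA.isHermitian.eq
  have h := integral_cexp_inner_add_inner (posSemidef_inv_one_sub_mul hA hB) hX hZ hXlaw hZlaw hXZ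
    (WithLp.toLp 2 ((a.ofLp - A *ᵥ a.ofLp) + b.ofLp)) (WithLp.toLp 2 (b.ofLp - A *ᵥ a.ofLp))
  simp only [quadratic_form_identity hA hB] at h
  rw [← h]
  refine integral_congr_ae (Filter.Eventually.of_forall fun ω => ?_)
  simp only
  congr 3
  have hs : ∀ x : Fin n → ℝ, (A *ᵥ x) ⬝ᵥ a.ofLp = x ⬝ᵥ (A *ᵥ a.ofLp) := fun x => by
    rw [Matrix.dotProduct_mulVec, ← Matrix.mulVec_transpose, hAt]
  simp only [real_inner_eq_dotProduct, WithLp.ofLp_sub, WithLp.ofLp_add, linearEstimator_eq_toLp,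
    Matrix.mulVec_add, sub_dotProduct, add_dotProduct, dotProduct_sub, dotProduct_add, hs]
  ring

theorem measurable_linearEstimator (A : Matrix (Fin n) (Fin n) ℝ) :
    Measurable (linearEstimator A) :=
  (continuous_linearEstimator A).measurable

theorem hasLaw_error (hA : A.PosDef) (hB : (1 - A).PosDef)
    (hX : Measurable X) (hZ : Measurable Z)
    (hXlaw : HasLaw X (multivariateGaussian 0 ((1 - A)⁻¹ * A)) P)
    (hZlaw : HasLaw Z (stdGaussian (EuclideanSpace ℝ (Fin n))) P) (hXZ : IndepFun X Z P) :
    HasLaw (fun ω => X ω - linearEstimator A (X ω + Z ω)) (multivariateGaussian 0 A) P := by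
  have hm := measurable_linearEstimator A
  have hW : Measurable fun ω => X ω - linearEstimator A (X ω + Z ω) := by fun_prop
  refine ⟨hW.aemeasurable, ?_⟩
  have := Measure.isProbabilityMeasure_map (μ := P) hW.aemeasurable
  refine Measure.ext_of_charFun ?_
  ext a
  have h := integral_cexp_error_observation hA hB hX hZ hXlaw hZlaw hXZ a 0
  rw [charFun_multivariateGaussian hA.posSemidef, charFun_apply,
    integral_map hW.aemeasurable (by fun_prop)]
  simp only [inner_zero_right, add_zero] at h
  rw [h, inner_zero_right]
  congr 1
  simp
  ring

theorem indepFun_error_observation (hA : A.PosDef) (hB : (1 - A).PosDef)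
    (hX : Measurable X) (hZ : Measurable Z)
    (hXlaw : HasLaw X (multivariateGaussian 0 ((1 - A)⁻¹ * A)) P)
    (hZlaw : HasLaw Z (stdGaussian (EuclideanSpace ℝ (Fin n))) P) (hXZ : IndepFun X Z P) :
    IndepFun (fun ω => X ω - linearEstimator A (X ω + Z ω)) (fun ω => X ω + Z ω) P := by
  have hm := measurable_linearEstimator A
  have hW : Measurable fun ω => X ω - linearEstimator A (X ω + Z ω) := by fun_prop
  have hY : Measurable fun ω => X ω + Z ω := by fun_prop
  rw [indepFun_iff_charFun_prod hW.aemeasurable hY.aemeasurable]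
  intro t
  have h1 := integral_cexp_error_observation hA hB hX hZ hXlaw hZlaw hXZ t.ofLp.1 t.ofLp.2
  have h2 := integral_cexp_error_observation hA hB hX hZ hXlaw hZlaw hXZ t.ofLp.1 0
  have h3 := integral_cexp_error_observation hA hB hX hZ hXlaw hZlaw hXZ 0 t.ofLp.2
  simp only [inner_zero_right, add_zero, zero_add] at h2 h3
  rw [charFun_apply, charFun_apply, charFun_apply, integral_map (by fun_prop) (by fun_prop),
    integral_map hW.aemeasurable (by fun_prop), integral_map hY.aemeasurable (by fun_prop)]
  simp only [WithLp.prod_inner_apply]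
  rw [h1, h2, h3, ← Complex.exp_add, ← Complex.ofReal_add]
  congr 2
  simp
  ring

end GaussianPrior

/-! ### Optimality and uniqueness for the Gaussian prior -/

section Optimality

/-- Both `|w|` and `|d|` are at most the mean of `|w + d|` and `|-w + d|`; convexity of the power
does the rest. Keeping the maximum, not just `|w|`, is what yields uniqueness. -/
theorem two_mul_max_rpow_le {p : ℝ} (hp : 1 ≤ p) (w d : ℝ) :
    2 * max |w| |d| ^ p ≤ |w + d| ^ p + |-w + d| ^ p := by
  have h1 : max |w| |d| ≤ (1 / 2) * |w + d| + (1 / 2) * |-w + d| := by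
    refine max_le ?_ ?_
    · have := abs_sub (w + d) (-w + d)
      have e : w + d - (-w + d) = 2 * w := by ring
      rw [e, abs_mul, abs_two] at this
      linarith
    · have := abs_add_le (w + d) (-w + d)
      have e : w + d + (-w + d) = 2 * d := by ring
      rw [e, abs_mul, abs_two] at this
      linarith
  have h2 := (convexOn_rpow hp).2 (abs_nonneg (w + d)) (abs_nonneg (-w + d))
    (by norm_num : (0 : ℝ) ≤ 1 / 2) (by norm_num : (0 : ℝ) ≤ 1 / 2) (by norm_num)
  simp only [smul_eq_mul] at h2
  have h3 := (Real.rpow_le_rpow (by positivity) h1 (by linarith : 0 ≤ p)).trans h2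
  linarith

variable {n : ℕ} {Ω : Type*} [MeasurableSpace Ω] {P : Measure Ω}
  {X Z : Ω → EuclideanSpace ℝ (Fin n)} {A : Matrix (Fin n) (Fin n) ℝ} {p : ℝ}

theorem bayesRisk_linearEstimator (hp : p ≠ 0) :
    _root_.bayesRisk P X (fun ω => X ω + Z ω) p p (linearEstimator A) =
      ∫⁻ ω, ENNReal.ofReal (∑ i, |(X ω - linearEstimator A (X ω + Z ω)) i| ^ p) ∂P :=
  lintegral_congr fun ω => by rw [lossFn_self hp]

variable [IsProbabilityMeasure P]

theorem map_neg_multivariateGaussian {S : Matrix (Fin n) (Fin n) ℝ} (hS : S.PosSemidef) :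
    (multivariateGaussian 0 S).map (fun x => -x) = multivariateGaussian 0 S := by
  have := Measure.isProbabilityMeasure_map (μ := multivariateGaussian 0 S)
    (measurable_neg (G := EuclideanSpace ℝ (Fin n))).aemeasurable
  refine Measure.ext_of_charFun ?_
  ext t
  have h : (fun x : EuclideanSpace ℝ (Fin n) => -x) = fun x => (-1 : ℝ) • x := by ext; simp
  rw [h, charFun_map_smul, charFun_multivariateGaussian hS, charFun_multivariateGaussian hS]
  simp [Matrix.mulVec_neg]

/-- An expectation of a function of a symmetric random vector and an independent one does not
change when the sign of the symmetric vector is reversed. -/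
theorem lintegral_comp_neg_of_indepFun {W Y : Ω → EuclideanSpace ℝ (Fin n)}
    (hW : Measurable W) (hY : Measurable Y) (hsymm : (P.map W).map (fun x => -x) = P.map W)
    (hind : IndepFun W Y P) {F : EuclideanSpace ℝ (Fin n) → EuclideanSpace ℝ (Fin n) → ℝ≥0∞}
    (hF : Measurable (Function.uncurry F)) :
    ∫⁻ ω, F (-W ω) (Y ω) ∂P = ∫⁻ ω, F (W ω) (Y ω) ∂P := by
  have h1 : P.map (fun ω => (W ω, Y ω)) = (P.map W).prod (P.map Y) :=
    (indepFun_iff_map_prod_eq_prod_map_map hW.aemeasurable hY.aemeasurable).1 hind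
  have hind' : IndepFun (fun ω => -W ω) Y P := hind.comp measurable_neg measurable_id
  have h2 : P.map (fun ω => (-W ω, Y ω)) = (P.map fun ω => -W ω).prod (P.map Y) :=
    (indepFun_iff_map_prod_eq_prod_map_map hW.neg.aemeasurable hY.aemeasurable).1 hind'
  have h3 : (P.map fun ω => -W ω) = P.map W :=
    (Measure.map_map measurable_neg hW).symm.trans hsymm
  rw [h3, ← h1] at h2
  have e1 := lintegral_map (μ := P) hF (hW.neg.prodMk hY)
  have e2 := lintegral_map (μ := P) hF (hW.prodMk hY)
  exact e1.symm.trans ((congrArg (fun μ => ∫⁻ q, Function.uncurry F q ∂μ) h2).trans e2)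

/-- For the Gaussian prior, the risk of any estimator exceeds that of `A y` by an explicit amount. -/
theorem lintegral_max_le_bayesRisk (hA : A.PosDef) (hB : (1 - A).PosDef)
    (hX : Measurable X) (hZ : Measurable Z)
    (hXlaw : HasLaw X (multivariateGaussian 0 ((1 - A)⁻¹ * A)) P)
    (hZlaw : HasLaw Z (stdGaussian (EuclideanSpace ℝ (Fin n))) P) (hXZ : IndepFun X Z P)
    (hp : 1 ≤ p) {g : EuclideanSpace ℝ (Fin n) → EuclideanSpace ℝ (Fin n)} (hg : Measurable g) :
    ∫⁻ ω, ENNReal.ofReal (∑ i, max |(X ω - linearEstimator A (X ω + Z ω)) i|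
      |(linearEstimator A (X ω + Z ω) - g (X ω + Z ω)) i| ^ p) ∂P ≤
      _root_.bayesRisk P X (fun ω => X ω + Z ω) p p g := by
  have hm := measurable_linearEstimator A
  have hp0 : p ≠ 0 := by linarith
  set W : Ω → EuclideanSpace ℝ (Fin n) := fun ω => X ω - linearEstimator A (X ω + Z ω) with hWdef
  set Y : Ω → EuclideanSpace ℝ (Fin n) := fun ω => X ω + Z ω with hYdef
  have hW : Measurable W := by fun_prop
  have hY : Measurable Y := by fun_prop
  set F : EuclideanSpace ℝ (Fin n) → EuclideanSpace ℝ (Fin n) → ℝ≥0∞ := fun w y =>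
    ENNReal.ofReal (∑ i, |w i + (linearEstimator A y - g y) i| ^ p) with hF
  have hFm : Measurable (Function.uncurry F) := by
    simp only [hF, Function.uncurry_def]
    fun_prop
  have hWlaw : P.map W = multivariateGaussian 0 A :=
    (hasLaw_error hA hB hX hZ hXlaw hZlaw hXZ).map_eq
  have hflip := lintegral_comp_neg_of_indepFun (P := P) (F := F) hW hY
    (by rw [hWlaw]; exact map_neg_multivariateGaussian hA.posSemidef)
    (indepFun_error_observation hA hB hX hZ hXlaw hZlaw hXZ) hFm
  have hrisk : _root_.bayesRisk P X Y p p g = ∫⁻ ω, F (W ω) (Y ω) ∂P := by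
    refine lintegral_congr fun ω => ?_
    rw [lossFn_self hp0]
    simp only [hF, hWdef, hYdef, PiLp.sub_apply, sub_add_sub_cancel]
  have hFW : Measurable fun ω => F (W ω) (Y ω) := by
    simp only [hF]
    fun_prop
  -- Twice the risk is the risk plus its copy with `W` replaced by `-W`, to which the pointwise
  -- inequality applies.
  have h2 : 2 * ∫⁻ ω, ENNReal.ofReal (∑ i, max |W ω i|
      |(linearEstimator A (Y ω) - g (Y ω)) i| ^ p) ∂P ≤ 2 * ∫⁻ ω, F (W ω) (Y ω) ∂P := by
    rw [← lintegral_const_mul _ (by fun_prop), two_mul (∫⁻ ω, F (W ω) (Y ω) ∂P)]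
    nth_rewrite 2 [← hflip]
    rw [← lintegral_add_left hFW]
    refine lintegral_mono fun ω => ?_
    simp only [hF]
    rw [← ENNReal.ofReal_add (Finset.sum_nonneg fun i _ => by positivity)
      (Finset.sum_nonneg fun i _ => by positivity), two_mul,
      ← ENNReal.ofReal_add (Finset.sum_nonneg fun i _ => by positivity)
      (Finset.sum_nonneg fun i _ => by positivity), ← two_mul, ← Finset.sum_add_distrib,
      Finset.mul_sum]
    refine ENNReal.ofReal_le_ofReal (Finset.sum_le_sum fun i _ => ?_)
    exact two_mul_max_rpow_le hp _ _
  rw [hrisk]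
  exact (ENNReal.mul_le_mul_iff_right (by norm_num) (by norm_num)).1 h2

theorem isOptimalEstimator_of_hasLaw (hA : A.PosDef) (hB : (1 - A).PosDef)
    (hX : Measurable X) (hZ : Measurable Z)
    (hXlaw : HasLaw X (multivariateGaussian 0 ((1 - A)⁻¹ * A)) P)
    (hZlaw : HasLaw Z (stdGaussian (EuclideanSpace ℝ (Fin n))) P) (hXZ : IndepFun X Z P)
    (hp : 1 ≤ p) : IsOptimalEstimator P X (fun ω => X ω + Z ω) p p (linearEstimator A) := by
  refine ⟨measurable_linearEstimator A, fun g hg => ?_⟩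
  refine le_trans ?_ (lintegral_max_le_bayesRisk hA hB hX hZ hXlaw hZlaw hXZ hp hg)
  rw [bayesRisk_linearEstimator (by linarith)]
  refine lintegral_mono fun ω => ENNReal.ofReal_le_ofReal (Finset.sum_le_sum fun i _ => ?_)
  exact Real.rpow_le_rpow (abs_nonneg _) (le_max_left _ _) (by linarith)

/-- Given `V = d ≠ 0`, independence leaves `U` Gaussian, and a nondegenerate Gaussian charges the
interval `(-|d|, |d|)`. -/
theorem ae_eq_zero_of_abs_le_of_indepFun {U V : Ω → ℝ} {v : NNReal} (hv : v ≠ 0)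
    (hU : Measurable U) (hV : Measurable V) (hUlaw : P.map U = gaussianReal 0 v)
    (hind : IndepFun V U P) (h : ∀ᵐ ω ∂P, |V ω| ≤ |U ω|) : ∀ᵐ ω ∂P, V ω = 0 := by
  have h1 : P.map (fun ω => (V ω, U ω)) = (P.map V).prod (P.map U) :=
    (indepFun_iff_map_prod_eq_prod_map_map hV.aemeasurable hU.aemeasurable).1 hind
  have hset : MeasurableSet {q : ℝ × ℝ | |q.1| ≤ |q.2|} :=
    measurableSet_le (by fun_prop) (by fun_prop)
  have h2 : ∀ᵐ q ∂(P.map V).prod (P.map U), |q.1| ≤ |q.2| := by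
    rw [← h1]
    exact (ae_map_iff (hV.prodMk hU).aemeasurable hset).2 h
  have h3 := Measure.ae_ae_of_ae_prod h2
  rw [hUlaw] at h3
  refine ae_of_ae_map (p := fun d => d = 0) hV.aemeasurable ?_
  filter_upwards [h3] with d hd
  by_contra hd0
  have h4 : ∀ᵐ u ∂(volume : Measure ℝ), |d| ≤ |u| := gaussianReal_absolutelyContinuous' 0 hv hd
  have hball : Metric.ball (0 : ℝ) |d| ⊆ {u : ℝ | ¬ |d| ≤ |u|} := fun u hu => by
    simpa using hu
  have h5 := measure_mono_null hball h4
  exact (Metric.measure_ball_pos volume (0 : ℝ) (abs_pos.2 hd0)).ne' h5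

/-- Equality of finite risks forces `max(|W_i|, |D_i|) = |W_i|` almost surely, where `D = A Y -
f(Y)` depends on `Y` only and is therefore independent of `W`. -/
theorem ae_eq_linearEstimator_of_isOptimalEstimator (hA : A.PosDef) (hB : (1 - A).PosDef)
    (hX : Measurable X) (hZ : Measurable Z)
    (hXlaw : HasLaw X (multivariateGaussian 0 ((1 - A)⁻¹ * A)) P)
    (hZlaw : HasLaw Z (stdGaussian (EuclideanSpace ℝ (Fin n))) P) (hXZ : IndepFun X Z P)
    (hp1 : 1 ≤ p) (hp2 : p ≤ 2) {f : EuclideanSpace ℝ (Fin n) → EuclideanSpace ℝ (Fin n)}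
    (hf : IsOptimalEstimator P X (fun ω => X ω + Z ω) p p f) :
    ∀ᵐ ω ∂P, f (X ω + Z ω) = linearEstimator A (X ω + Z ω) := by
  have hm := measurable_linearEstimator A
  have hfm := hf.1
  have hp0 : 0 < p := by linarith
  set W : Ω → EuclideanSpace ℝ (Fin n) := fun ω => X ω - linearEstimator A (X ω + Z ω) with hWdef
  set D : Ω → EuclideanSpace ℝ (Fin n) := fun ω =>
    linearEstimator A (X ω + Z ω) - f (X ω + Z ω) with hDdef
  have hW : Measurable W := by fun_prop
  have hD : Measurable D := by fun_prop
  have hlow := lintegral_max_le_bayesRisk hA hB hX hZ hXlaw hZlaw hXZ hp1 hf.1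
  have hle := hlow.trans (hf.2 _ hm)
  rw [bayesRisk_linearEstimator hp0.ne'] at hle
  have hfin : ∫⁻ ω, ENNReal.ofReal (∑ i, |W ω i| ^ p) ∂P ≠ ∞ := by
    have := bayesRisk_linearEstimator (P := P) (X := X) (Z := Z) (A := A) hp0.ne'
    rw [← this]
    exact (((isOptimalEstimator_of_hasLaw hA hB hX hZ hXlaw hZlaw hXZ hp1).2 id
      measurable_id).trans_lt (bayesRisk_id_lt_top hZ hZlaw hp1 hp2)).ne
  have hmono : ∀ ω, ∀ i, |W ω i| ^ p ≤ max |W ω i| |D ω i| ^ p := fun ω i =>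
    Real.rpow_le_rpow (abs_nonneg _) (le_max_left _ _) hp0.le
  have hae := ae_eq_of_ae_le_of_lintegral_le
    (f := fun ω => ENNReal.ofReal (∑ i, |W ω i| ^ p))
    (g := fun ω => ENNReal.ofReal (∑ i, max |W ω i| |D ω i| ^ p)) (μ := P)
    (Filter.Eventually.of_forall fun ω =>
      ENNReal.ofReal_le_ofReal (Finset.sum_le_sum fun i _ => hmono ω i)) hfin (by fun_prop) hle
  have habs : ∀ᵐ ω ∂P, ∀ i, |D ω i| ≤ |W ω i| := by
    filter_upwards [hae] with ω hω i
    have h1 : ∑ i, |W ω i| ^ p = ∑ i, max |W ω i| |D ω i| ^ p :=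
      (ENNReal.ofReal_eq_ofReal_iff (Finset.sum_nonneg fun i _ => by positivity)
        (Finset.sum_nonneg fun i _ => by positivity)).1 hω
    have h2 := (Finset.sum_eq_sum_iff_of_le fun i _ => hmono ω i).1 h1 i (Finset.mem_univ i)
    by_contra! hlt
    rw [max_eq_right hlt.le] at h2
    exact absurd h2 (Real.rpow_lt_rpow (abs_nonneg _) hlt hp0).ne
  have hind := indepFun_error_observation hA hB hX hZ hXlaw hZlaw hXZ
  have hWlaw := hasLaw_error hA hB hX hZ hXlaw hZlaw hXZ
  have hzero : ∀ᵐ ω ∂P, ∀ i, D ω i = 0 := by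
    rw [ae_all_iff]
    intro i
    refine ae_eq_zero_of_abs_le_of_indepFun (U := fun ω => W ω i) (v := (A i i).toNNReal)
      (Real.toNNReal_pos.2 hA.diag_pos).ne' (by fun_prop) (by fun_prop) ?_ ?_
      (habs.mono fun ω h => h i)
    · have h1 := (measurePreserving_eval_multivariateGaussian (μ := 0) hA.posSemidef (i := i)).map_eq
      rw [← hWlaw.map_eq, Measure.map_map (by fun_prop) hW] at h1
      exact h1
    · exact hind.symm.comp (φ := fun y => (linearEstimator A y - f y) i) (ψ := fun w => w i)
        (by fun_prop) (by fun_prop)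
  filter_upwards [hzero] with ω hω
  have : D ω = 0 := by ext i; simpa using hω i
  exact (sub_eq_zero.1 this).symm

end Optimality

/-! ### Recovering the prior from the density of the observation -/

section Necessity

variable {n : ℕ} {Ω : Type*} [MeasurableSpace Ω] {P : Measure Ω} [IsProbabilityMeasure P]
  {X Z : Ω → EuclideanSpace ℝ (Fin n)} {A : Matrix (Fin n) (Fin n) ℝ} {p : ℝ}

/-- The observation `X + Z` has density proportional to the Gaussian average. -/
theorem map_add_eq_withDensity_gaussAverage {C : ℝ} (hC : 0 < C)
    (hg : stdGaussian (EuclideanSpace ℝ (Fin n)) =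
      volume.withDensity fun z => ENNReal.ofReal (C * Real.exp (-‖z‖ ^ 2 / 2)))
    (hX : Measurable X) (hZ : Measurable Z)
    (hZlaw : HasLaw Z (stdGaussian (EuclideanSpace ℝ (Fin n))) P) (hXZ : IndepFun X Z P) :
    P.map (fun ω => X ω + Z ω) =
      volume.withDensity fun y => ENNReal.ofReal (C * gaussAverage P X y) := by
  ext s hs
  have h1 : Measurable (s.indicator (1 : EuclideanSpace ℝ (Fin n) → ℝ≥0∞)) :=
    measurable_one.indicator hs
  rw [← lintegral_indicator_one hs, lintegral_map h1 (hX.fun_add hZ),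
    lintegral_gaussianChannel hg hX hZlaw hXZ (F := fun _ y => s.indicator 1 y)
      (h1.comp measurable_snd), withDensity_apply _ hs, ← lintegral_indicator hs]
  refine lintegral_congr fun y => ?_
  by_cases hy : y ∈ s
  · simp only [Set.indicator_of_mem hy, Pi.one_apply, mul_one]
    rw [gaussAverage, ← integral_const_mul, ofReal_integral_eq_lintegral_ofReal
      ((integrable_gaussAverage hX y).const_mul C)
      (Filter.Eventually.of_forall fun ω => by positivity)]
  · simp [Set.indicator_of_notMem hy]

theorem gaussAverage_eq_of_isOptimalEstimator (hX : Measurable X) (hZ : Measurable Z)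
    (hZlaw : HasLaw Z (stdGaussian (EuclideanSpace ℝ (Fin n))) P) (hXZ : IndepFun X Z P)
    (hp1 : 1 ≤ p) (hp2 : p ≤ 2) (hA : A.PosDef)
    (hopt : IsOptimalEstimator P X (fun ω => X ω + Z ω) p p (linearEstimator A))
    (y : EuclideanSpace ℝ (Fin n)) :
    gaussAverage P X y =
      gaussAverage P X 0 * Real.exp ((y.ofLp ⬝ᵥ (A *ᵥ y.ofLp)) / 2 - ‖y‖ ^ 2 / 2) :=
  gaussAverage_eq_of_minimizer hX hp1 hp2 hA (fun i y c =>
    gaussDeviation_le_of_isOptimalEstimator hX hZ hZlaw hXZ hp1 hp2 (continuous_linearEstimator A)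
      hopt i y c) y

/-- Proportional Gaussian averages come from observations with the same law. -/
theorem map_add_eq_map_add_of_gaussAverage_eq_mul {Ω' : Type*} [MeasurableSpace Ω']
    {P' : Measure Ω'} [IsProbabilityMeasure P'] {X' Z' : Ω' → EuclideanSpace ℝ (Fin n)}
    (hX : Measurable X) (hZ : Measurable Z)
    (hZlaw : HasLaw Z (stdGaussian (EuclideanSpace ℝ (Fin n))) P) (hXZ : IndepFun X Z P)
    (hX' : Measurable X') (hZ' : Measurable Z')
    (hZlaw' : HasLaw Z' (stdGaussian (EuclideanSpace ℝ (Fin n))) P') (hXZ' : IndepFun X' Z' P')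
    {r : ℝ} (hr : 0 ≤ r) (h : ∀ y, gaussAverage P X y = r * gaussAverage P' X' y) :
    P.map (fun ω => X ω + Z ω) = P'.map (fun ω => X' ω + Z' ω) := by
  obtain ⟨C, hC, hg⟩ := exists_stdGaussian_eq_withDensity (EuclideanSpace ℝ (Fin n))
  have e := map_add_eq_withDensity_gaussAverage hC hg hX hZ hZlaw hXZ
  have e' := map_add_eq_withDensity_gaussAverage hC hg hX' hZ' hZlaw' hXZ'
  have hsmul : P.map (fun ω => X ω + Z ω) =
      ENNReal.ofReal r • P'.map (fun ω => X' ω + Z' ω) := by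
    rw [e, e', ← withDensity_smul' _ _ ENNReal.ofReal_ne_top]
    congr 1
    ext y
    rw [Pi.smul_apply, smul_eq_mul, ← ENNReal.ofReal_mul hr, h y, mul_left_comm]
  have := Measure.isProbabilityMeasure_map (μ := P) (hX.fun_add hZ).aemeasurable
  -- Proportional probability measures are equal, so the unknown ratio `r` must be `1`.
  have := Measure.isProbabilityMeasure_map (μ := P') (hX'.fun_add hZ').aemeasurable
  have h1 := congrArg (fun μ => μ Set.univ) hsmul
  simp only [Measure.smul_apply, smul_eq_mul] at h1
  simp only [measure_univ, mul_one] at h1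
  rw [hsmul, ← h1, one_smul]

/-- A law is determined by its convolution with the standard Gaussian. -/
theorem map_eq_map_of_map_add_eq {Ω' : Type*} [MeasurableSpace Ω']
    {P' : Measure Ω'} [IsProbabilityMeasure P'] {X' Z' : Ω' → EuclideanSpace ℝ (Fin n)}
    (hX : Measurable X) (hZlaw : HasLaw Z (stdGaussian (EuclideanSpace ℝ (Fin n))) P)
    (hXZ : IndepFun X Z P) (hX' : Measurable X')
    (hZlaw' : HasLaw Z' (stdGaussian (EuclideanSpace ℝ (Fin n))) P') (hXZ' : IndepFun X' Z' P')
    (h : P.map (fun ω => X ω + Z ω) = P'.map (fun ω => X' ω + Z' ω)) : P.map X = P'.map X' := by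
  have := Measure.isProbabilityMeasure_map (μ := P) hX.aemeasurable
  have := Measure.isProbabilityMeasure_map (μ := P') hX'.aemeasurable
  refine Measure.ext_of_charFun ?_
  have h1 := hXZ.charFun_map_fun_add_eq_mul hX.aemeasurable hZlaw.aemeasurable
  have h2 := hXZ'.charFun_map_fun_add_eq_mul hX'.aemeasurable hZlaw'.aemeasurable
  rw [h, h2, hZlaw.map_eq, hZlaw'.map_eq] at h1
  ext t
  have h3 := congrFun h1 t
  simp only [Pi.mul_apply, charFun_stdGaussian] at h3
  exact (mul_right_cancel₀ (Complex.exp_ne_zero _) h3).symm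

/-- The Gaussian prior is realised on a product space as a reference model. The linear estimator is
optimal there too, so both observations have the same density up to a factor, and deconvolution
identifies the priors. -/
theorem hasLaw_of_isOptimalEstimator (hX : Measurable X) (hZ : Measurable Z)
    (hZlaw : HasLaw Z (stdGaussian (EuclideanSpace ℝ (Fin n))) P) (hXZ : IndepFun X Z P)
    (hp1 : 1 ≤ p) (hp2 : p ≤ 2) (hA : A.PosDef) (hB : (1 - A).PosDef)
    (hopt : IsOptimalEstimator P X (fun ω => X ω + Z ω) p p (linearEstimator A)) :
    HasLaw X (multivariateGaussian 0 ((1 - A)⁻¹ * A)) P := by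
  let E := EuclideanSpace ℝ (Fin n)
  let μ : Measure E := multivariateGaussian 0 ((1 - A)⁻¹ * A)
  let ν : Measure E := stdGaussian E
  have hfst : HasLaw (Prod.fst : E × E → E) μ (μ.prod ν) :=
    ⟨measurable_fst.aemeasurable, measurePreserving_fst.map_eq⟩
  have hsnd : HasLaw (Prod.snd : E × E → E) ν (μ.prod ν) :=
    ⟨measurable_snd.aemeasurable, measurePreserving_snd.map_eq⟩
  have hind : IndepFun (Prod.fst : E × E → E) Prod.snd (μ.prod ν) :=
    indepFun_prod measurable_id measurable_id
  have hopt' := isOptimalEstimator_of_hasLaw hA hB measurable_fst measurable_snd hfst hsnd hind hp1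
  have h := gaussAverage_eq_of_isOptimalEstimator hX hZ hZlaw hXZ hp1 hp2 hA hopt
  have h' := gaussAverage_eq_of_isOptimalEstimator measurable_fst measurable_snd hsnd hind hp1 hp2
    hA hopt'
  have hpos := gaussAverage_pos (P := P) hX 0
  have hpos' := gaussAverage_pos (P := μ.prod ν) (measurable_fst : Measurable Prod.fst) 0
  have hmap := map_add_eq_map_add_of_gaussAverage_eq_mul hX hZ hZlaw hXZ measurable_fst
    measurable_snd hsnd hind (div_nonneg hpos.le hpos'.le) fun y => by
      rw [h y, h' y, ← mul_assoc, div_mul_cancel₀ _ hpos'.ne']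
  exact ⟨hX.aemeasurable, (map_eq_map_of_map_add_eq hX hZlaw hXZ measurable_fst hsnd hind
    hmap).trans hfst.map_eq⟩

end Necessity

/-! ### The main theorem -/

theorem mainTheorem1 {n : ℕ} {Ω : Type*} [MeasurableSpace Ω] (P : Measure Ω)
    [IsProbabilityMeasure P] (X Z : Ω → EuclideanSpace ℝ (Fin n))
    (hX : Measurable X) (hZ : Measurable Z)
    (hZlaw : HasLaw Z (stdGaussian (EuclideanSpace ℝ (Fin n))) P)
    (hXZ : IndepFun X Z P)
    (p k : ℝ) (hpk : p = k) (hp1 : 1 ≤ p) (hp2 : p ≤ 2)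
    (A : Matrix (Fin n) (Fin n) ℝ) (hA : A.PosDef) :
    ((1 - A).PosDef →
      (IsOptimalEstimator P X (fun ω => X ω + Z ω) p k (linearEstimator A) ↔
        HasLaw X (multivariateGaussian 0 ((1 - A)⁻¹ * A)) P) ∧
      (IsOptimalEstimator P X (fun ω => X ω + Z ω) p k (linearEstimator A) →
        ∀ f : EuclideanSpace ℝ (Fin n) → EuclideanSpace ℝ (Fin n),
          IsOptimalEstimator P X (fun ω => X ω + Z ω) p k f →
            ∀ᵐ ω ∂P, f (X ω + Z ω) = linearEstimator A (X ω + Z ω))) ∧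
    ((∃ l : ℝ, 1 ≤ l ∧ Module.End.HasEigenvalue (Matrix.toLin' A) l) →
      ¬ IsOptimalEstimator P X (fun ω => X ω + Z ω) p k (linearEstimator A)) := by
  subst hpk
  refine ⟨fun hB => ?_, fun ⟨l, hl, hlA⟩ =>
    not_isOptimalEstimator_of_eigenvalue hX hZ hZlaw hXZ hp1 hp2 hA hl hlA⟩
  have hlaw := hasLaw_of_isOptimalEstimator hX hZ hZlaw hXZ hp1 hp2 hA hB
  exact ⟨⟨hlaw, fun h => isOptimalEstimator_of_hasLaw hA hB hX hZ h hZlaw hXZ hp1⟩,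
    fun hopt f hf => ae_eq_linearEstimator_of_isOptimalEstimator hA hB hX hZ (hlaw hopt) hZlaw hXZ
      hp1 hp2 hf⟩
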